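/- **Setting (local).** Let $V$ be a real vector space of dimension $2n$ with a symplectic form $\omega$, and let $M\subset V$ be open with a special Kähler structure in flat coordinates: the flat torsion-free connection $\nabla$ is the ordinary derivative on $V$, the Kähler form is the constant form $\omega$, the complex structure $I$ is smooth with $I^2=-1$, $\omega(I\cdot,I\cdot)=\omega$ and $d_\nabla I=0$, and $g(A,B)=\omega(A,IB)$ is positive definite. (Every special Kähler manifold is locally of this form.) Let $\phi$ be a smooth real function on $M$ with $\partial^2\phi/\partial x_j\partial x_k=g_{jk}$ in linear coordinates $x_1,\dots,x_{2n}$ on $V$, and put $\xi_j=\partial\phi/\partial x_j$. On $M\times V=M\times\mathbf R^{2n}$, with coordinates $(x,y)$, let $$\omega_1=\sum\frac{\partial^2\phi}{\partial x_j\partial x_k}\,dx_j\wedge dy_k,\qquad \omega_2+i\omega_3=-\tfrac12\sum\omega_{jk}\,d(x_j+iy_j)\wedge d(x_k+iy_k).$$ Choose any symplectic basis of $V$, so that $\omega=\sum_{j=1}^n dx_j\wedge dx_{n+j}$, and put $v_j=x_j+i\xi_{n+j}$, $w_j=\xi_j+ix_{n+j}$ for $1\le j\le n$. A holomorphic prepotential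 on an open set $N\subset M$ is a holomorphic function $\mathcal F$ on $w(N)\subset\mathbf C^n$, with $w(N)$ open, such that $v_j=\partial\mathcal F/\partial w_j$ on $N$. **The Legendre transform construction.** Let $F$ be a smooth real function on an open set $D\subset\mathbf R^n\otimes\mathbf R^3$, whose points are $(\mathbf x_1,\dots,\mathbf x_n)$, $\mathbf x_j=(\xi_j,\mathrm{Re}\,z_j,\mathrm{Im}\,z_j)$, such that $\mathbf x\mapsto F(\mathbf p_1+c_1\mathbf x,\dots,\mathbf p_n+c_n\mathbf x)$ is harmonic on the set of $\mathbf x\in\mathbf R^3$ where it is defined, for all $c\in\mathbf R^n$ and $\mathbf p$; that $\partial^2F/\partial(\mathrm{Re}\,z_j)\partial(\mathrm{Im}\,z_k)$ is symmetric in $j,k$ (together: $F_{\xi_j\xi_k}+4F_{z_j\bar z_k}=0$); that $(\partial^2F/\partial\xi_j\partial\xi_k)$ is invertible; and that $\xi$ is determined by $z$ and $\partial F/\partial\xi$. On the set $X_F\subset\mathbf C^n\times\mathbf C^n$ of those $(u,z)$ for which some $\xi$ with $(\xi,z)\in D$ satisfies $\partial F/\partial\xi_j=u_j+\bar u_j$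 for all $j$, one puts $$K=F-\sum_{k=1}^n(u_k+\bar u_k)\xi_k,\qquad \omega_1^F=-2i\,\partial\bar\partial K,\qquad \omega_2^F+i\omega_3^F=2i\sum_{j=1}^n du_j\wedge dz_j,$$ with metric $\omega_1^F(\cdot,i\,\cdot)$; $\mathbf R^n$ acts by translations of the imaginary parts of the $u_j$. **Claim.** 1. $\omega_1,\omega_2,\omega_3$ are symplectic forms which define a hyperkähler structure on $M\times V$, with metric $\sum\frac{\partial^2\phi}{\partial x_j\partial x_k}(dx_jdx_k+dy_jdy_k)$. 2. The action of $\mathbf R^n$ generated by $U_j=-\partial/\partial y_j$, $1\le j\le n$, preserves the three forms and has the equivariant hyperkähler moment map $\mu(x,y)=(\xi_j,-y_{n+j},x_{n+j})_{1\le j\le n}\in\mathbf R^n\otimes\mathbf R^3$. 3. Every point of $M$ has an open neighbourhood in $M$ with a holomorphic prepotential. 4. Let $\mathcal F$ be a holomorphic prepotential on an open set $N\subset M$. Put $D=\mu(N\times V)$ and $F(\mathbf x_1,\dots,\mathbf x_n)=\mathrm{Re}\,\mathcal F(\xi_1+i\,\mathrm{Im}\,z_1,\dots,\xi_n+i\,\mathrm{Im}\,z_n)$.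 Then $D$ is open, the fibres of $\mu:N\times V\to D$ are free $\mathbf R^n$-orbits, $F$ satisfies on $D$ all the conditions above, and the forms $\omega_i^F$ define on $X_F$ a hyperkähler structure with metric $\omega_1^F(\cdot,i\,\cdot)$. The real linear isomorphism $$u_j=\tfrac12(x_j+iy_j),\qquad z_j=i(x_{n+j}+iy_{n+j})\qquad(1\le j\le n)$$ maps $N\times V$ onto $X_F$, pulls $\omega_i^F$ back to $\omega_i$ for $i=1,2,3$ and the metric of $X_F$ back to that of $N\times V$, takes the action of $t\in\mathbf R^n$ generated by the $U_j$ to $u\mapsto u-\tfrac i2t$, and identifies $\mu$ with $(\xi,z)$. If $N$ is connected, then $K=-\phi$ up to an additive constant. -/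

import Mathlib

open Set
open scoped ContDiff

noncomputable section

/-! ### Hyperkähler triples of symplectic forms on an open set of a real vector space -/

section Hyperkahler

variable {P : Type*} [NormedAddCommGroup P] [NormedSpace ℝ P]

/-- `σ` is a symplectic form on the open set `X`: smooth, alternating, nondegenerate and closed
(the last condition is `dσ (A, B, C) = 0` for constant vector fields `A`, `B`, `C`). -/
structure IsSymplecticForm (X : Set P) (σ : P → LinearMap.BilinForm ℝ P) : Prop where
  smooth : ∀ A B : P, ContDiffOn ℝ ∞ (fun p => σ p A B) X
  alt : ∀ p ∈ X, ∀ A : P, σ p A A = 0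
  nondeg : ∀ p ∈ X, ∀ A : P, (∀ B : P, σ p A B = 0) → A = 0
  closed : ∀ p ∈ X, ∀ A B C : P,
    fderiv ℝ (fun q => σ q B C) p A + fderiv ℝ (fun q => σ q C A) p B
      + fderiv ℝ (fun q => σ q A B) p C = 0

/-- The symplectic forms `σ₁, σ₂, σ₃` determine on the open set `X` a hyperkähler structure with
(positive definite) metric `G`.  With `φᵢ : T → T*`, `φᵢ A = σᵢ (A, ·)`, the endomorphisms
`J₁ = φ₃⁻¹ φ₂`, `J₂ = φ₁⁻¹ φ₃`, `J₃ = φ₂⁻¹ φ₁` satisfy the quaternionic identities, and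
`G (A, B) = σᵢ (A, Jᵢ B)` for each `i`. As the `σᵢ` are nondegenerate, they determine the `Jᵢ`
and hence `G`. -/
structure IsHyperkahler (X : Set P) (σ₁ σ₂ σ₃ : P → LinearMap.BilinForm ℝ P)
    (G : P → LinearMap.BilinForm ℝ P) : Prop where
  isOpen : IsOpen X
  symplectic₁ : IsSymplecticForm X σ₁
  symplectic₂ : IsSymplecticForm X σ₂
  symplectic₃ : IsSymplecticForm X σ₃
  metric_symm : ∀ p ∈ X, ∀ A B : P, G p A B = G p B A
  metric_pos : ∀ p ∈ X, ∀ A : P, A ≠ 0 → 0 < G p A A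
  quaternionic : ∀ p ∈ X, ∃ J₁ J₂ J₃ : P →ₗ[ℝ] P,
    (∀ A B, σ₃ p (J₁ A) B = σ₂ p A B) ∧
    (∀ A B, σ₁ p (J₂ A) B = σ₃ p A B) ∧
    (∀ A B, σ₂ p (J₃ A) B = σ₁ p A B) ∧
    (∀ A, J₁ (J₁ A) = -A) ∧ (∀ A, J₂ (J₂ A) = -A) ∧ (∀ A, J₃ (J₃ A) = -A) ∧
    (∀ A, J₂ (J₃ A) = J₁ A) ∧ (∀ A, J₃ (J₂ A) = -J₁ A) ∧
    (∀ A B, σ₁ p A (J₁ B) = G p A B) ∧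
    (∀ A B, σ₂ p A (J₂ B) = G p A B) ∧
    (∀ A B, σ₃ p A (J₃ B) = G p A B)

/-- The space `ℝⁿ ⊗ ℝ³` of `n`-tuples `(𝐱₁, …, 𝐱ₙ)` of points of Euclidean `ℝ³`. -/
abbrev R3n (n : ℕ) : Type := Fin n → EuclideanSpace ℝ (Fin 3)

/-- The constant vector fields `U₁, …, Uₙ` generate the action
`t · p = p + ∑ tⱼ Uⱼ` of `ℝⁿ` on `X`; it preserves the three forms, and `μ : X → ℝⁿ ⊗ ℝ³` is an
equivariant hyperkähler moment map for it: `ι(Uⱼ) σᵢ = d μⱼᵢ`, and `μ` is constant on orbits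
(the coadjoint action of `ℝⁿ` being trivial). -/
structure IsEquivariantMomentMap {n : ℕ} (X : Set P) (σ₁ σ₂ σ₃ : P → LinearMap.BilinForm ℝ P)
    (U : Fin n → P) (μ : P → R3n n) : Prop where
  action : ∀ t : Fin n → ℝ, ∀ p ∈ X, p + ∑ j, t j • U j ∈ X
  invariant : ∀ t : Fin n → ℝ, ∀ p ∈ X,
    σ₁ (p + ∑ j, t j • U j) = σ₁ p ∧ σ₂ (p + ∑ j, t j • U j) = σ₂ p ∧
      σ₃ (p + ∑ j, t j • U j) = σ₃ p
  smooth : ContDiffOn ℝ ∞ μ X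
  moment₁ : ∀ p ∈ X, ∀ (j : Fin n) (A : P), σ₁ p (U j) A = fderiv ℝ (fun q => μ q j 0) p A
  moment₂ : ∀ p ∈ X, ∀ (j : Fin n) (A : P), σ₂ p (U j) A = fderiv ℝ (fun q => μ q j 1) p A
  moment₃ : ∀ p ∈ X, ∀ (j : Fin n) (A : P), σ₃ p (U j) A = fderiv ℝ (fun q => μ q j 2) p A
  equivariant : ∀ t : Fin n → ℝ, ∀ p ∈ X, μ (p + ∑ j, t j • U j) = μ p

end Hyperkahler

/-! ### Special Kähler structures in flat coordinates, and the prepotential -/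

section SpecialKahler

variable {V : Type*} [NormedAddCommGroup V] [NormedSpace ℝ V]

/-- A special Kähler structure on an open set `M` of `V`, in flat coordinates: the flat
torsion-free connection `∇` is the ordinary derivative of `V`, the Kähler form `Ω` is constant
(`∇Ω = 0`), the complex structure `I` satisfies `d_∇ I = 0` (which implies that it is integrable),
and the Kähler metric `g (A, B) = Ω (A, I B)` is positive definite. -/
structure IsSpecialKahler (Ω : LinearMap.BilinForm ℝ V) (M : Set V) (I : V → V →L[ℝ] V) :
    Prop where
  isOpen : IsOpen M
  alt : Ω.IsAlt
  nondeg : Ω.Nondegenerate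
  smooth : ContDiffOn ℝ ∞ I M
  sq : ∀ x ∈ M, ∀ A : V, I x (I x A) = -A
  d_nabla : ∀ x ∈ M, ∀ A B : V, fderiv ℝ I x A B = fderiv ℝ I x B A
  compatible : ∀ x ∈ M, ∀ A B : V, Ω (I x A) (I x B) = Ω A B
  pos : ∀ x ∈ M, ∀ A : V, A ≠ 0 → 0 < Ω A (I x A)

/-- The second derivative `∂²φ/∂xⱼ∂xₖ` of a function, as a bilinear form. -/
def hessian (φ : V → ℝ) (x : V) : V →L[ℝ] V →L[ℝ] ℝ := fderiv ℝ (fderiv ℝ φ) x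

/-- `φ` is the real potential of the special Kähler structure: a smooth function on `M` whose
second derivatives in the flat coordinates are the coefficients of the Kähler metric. -/
structure IsSpecialPotential (Ω : LinearMap.BilinForm ℝ V) (M : Set V) (I : V → V →L[ℝ] V)
    (φ : V → ℝ) : Prop where
  smooth : ContDiffOn ℝ ∞ φ M
  hessian_eq : ∀ x ∈ M, ∀ A B : V, hessian φ x A B = Ω A (I x B)

/-- A symplectic basis; in its linear coordinates `x₁, …, x₂ₙ` (`inl j` is the index `j`, and
`inr j` is the index `n + j`) one has `Ω = ∑ dxⱼ ∧ dxₙ₊ⱼ`. -/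
structure IsSymplecticBasis {n : ℕ} (Ω : LinearMap.BilinForm ℝ V)
    (b : Module.Basis (Fin n ⊕ Fin n) ℝ V) : Prop where
  inl_inl : ∀ i j : Fin n, Ω (b (Sum.inl i)) (b (Sum.inl j)) = 0
  inr_inr : ∀ i j : Fin n, Ω (b (Sum.inr i)) (b (Sum.inr j)) = 0
  inl_inr : ∀ i j : Fin n, Ω (b (Sum.inl i)) (b (Sum.inr j)) = if i = j then 1 else 0

variable {n : ℕ}

/-- The functions `ξₖ = ∂φ/∂xₖ`, `1 ≤ k ≤ 2n`. -/
def xi (b : Module.Basis (Fin n ⊕ Fin n) ℝ V) (φ : V → ℝ) (k : Fin n ⊕ Fin n) (x : V) : ℝ :=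
  fderiv ℝ φ x (b k)

/-- The complex functions `vⱼ = xⱼ + i ξₙ₊ⱼ`, `1 ≤ j ≤ n`. -/
def vCoord (b : Module.Basis (Fin n ⊕ Fin n) ℝ V) (φ : V → ℝ) (x : V) : Fin n → ℂ :=
  fun j => (b.repr x (Sum.inl j) : ℂ) + Complex.I * (xi b φ (Sum.inr j) x : ℂ)

/-- The complex functions `wⱼ = ξⱼ + i xₙ₊ⱼ`, `1 ≤ j ≤ n`. -/
def wCoord (b : Module.Basis (Fin n ⊕ Fin n) ℝ V) (φ : V → ℝ) (x : V) : Fin n → ℂ :=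
  fun j => (xi b φ (Sum.inl j) x : ℂ) + Complex.I * (b.repr x (Sum.inr j) : ℂ)

/-- `𝓕` is a holomorphic prepotential on `M`: it is a holomorphic function of `w₁, …, wₙ`, defined
on the open set `w(M)` of `ℂⁿ`, with `vⱼ = ∂𝓕/∂wⱼ` on `M`; so the Lagrangian submanifold
`{(v(x), w(x)) : x ∈ M}` of `T*ℂⁿ` is the graph of the derivative of `𝓕`. -/
structure IsPrepotential (b : Module.Basis (Fin n ⊕ Fin n) ℝ V) (φ : V → ℝ) (M : Set V)
    (𝓕 : (Fin n → ℂ) → ℂ) : Prop where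
  isOpen : IsOpen (wCoord b φ '' M)
  holo : DifferentiableOn ℂ 𝓕 (wCoord b φ '' M)
  graph : ∀ x ∈ M, ∀ j : Fin n, vCoord b φ x j = fderiv ℂ 𝓕 (wCoord b φ x) (Pi.single j 1)

/-! ### The Cecotti–Ferrara–Girardello metric on `M × V` (points `(x, y)`, `V = ℝ²ⁿ`) -/

/-- `ω₁ = ∑ (∂²φ/∂xⱼ∂xₖ) dxⱼ ∧ dyₖ`. -/
def cfgOmega₁ (φ : V → ℝ) (p : V × V) : LinearMap.BilinForm ℝ (V × V) :=
  LinearMap.mk₂ ℝ (fun A B => hessian φ p.1 A.1 B.2 - hessian φ p.1 B.1 A.2)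
    (by intros; simp; ring) (by intros; simp; ring)
    (by intros; simp; ring) (by intros; simp; ring)

/-- The real part `ω₂` of `ω₂ + i ω₃ = -½ ∑ ωⱼₖ d(xⱼ + i yⱼ) ∧ d(xₖ + i yₖ)`, a complex form which
on `(A, B)` is `-Ω (A₁ + i A₂, B₁ + i B₂)`, where `Ω` is extended complex bilinearly. -/
def cfgOmega₂ (Ω : LinearMap.BilinForm ℝ V) (_p : V × V) : LinearMap.BilinForm ℝ (V × V) :=
  LinearMap.mk₂ ℝ (fun A B => -(Ω A.1 B.1 - Ω A.2 B.2))
    (by intros; simp; ring) (by intros; simp; ring)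
    (by intros; simp; ring) (by intros; simp; ring)

/-- The imaginary part `ω₃` of `ω₂ + i ω₃ = -½ ∑ ωⱼₖ d(xⱼ + i yⱼ) ∧ d(xₖ + i yₖ)`. -/
def cfgOmega₃ (Ω : LinearMap.BilinForm ℝ V) (_p : V × V) : LinearMap.BilinForm ℝ (V × V) :=
  LinearMap.mk₂ ℝ (fun A B => -(Ω A.1 B.2 + Ω A.2 B.1))
    (by intros; simp; ring) (by intros; simp; ring)
    (by intros; simp; ring) (by intros; simp; ring)

/-- The metric `∑ (∂²φ/∂xⱼ∂xₖ) (dxⱼ dxₖ + dyⱼ dyₖ)` of the triple `ω₁, ω₂, ω₃`. -/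
def cfgMetric (φ : V → ℝ) (p : V × V) : LinearMap.BilinForm ℝ (V × V) :=
  LinearMap.mk₂ ℝ (fun A B => hessian φ p.1 A.1 B.1 + hessian φ p.1 A.2 B.2)
    (by intros; simp; ring) (by intros; simp; ring)
    (by intros; simp; ring) (by intros; simp; ring)

/-- The vector fields `Uⱼ = -∂/∂yⱼ`, `1 ≤ j ≤ n`. -/
def cfgField (b : Module.Basis (Fin n ⊕ Fin n) ℝ V) (j : Fin n) : V × V := (0, -b (Sum.inl j))

/-- The map `(x, y) ↦ (ξⱼ, -yₙ₊ⱼ, xₙ₊ⱼ)ⱼ` to `ℝⁿ ⊗ ℝ³`. -/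
def cfgMoment (b : Module.Basis (Fin n ⊕ Fin n) ℝ V) (φ : V → ℝ) (p : V × V) : R3n n :=
  fun j => !₂[xi b φ (Sum.inl j) p.1, -b.repr p.2 (Sum.inr j), b.repr p.1 (Sum.inr j)]

end SpecialKahler

/-! ### The Legendre transform construction -/

section Legendre

variable {n : ℕ}

/-- The complex coordinate space of points `(u, z)`, with `u` and `z` in `ℂⁿ`. -/
abbrev UZ (n : ℕ) : Type := (Fin n → ℂ) × (Fin n → ℂ)

/-- The point of `ℝⁿ ⊗ ℝ³` with `𝐱ⱼ = (ξⱼ, Re zⱼ, Im zⱼ)`. -/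
def r3pt (ξ : Fin n → ℝ) (z : Fin n → ℂ) : R3n n := fun j => !₂[ξ j, (z j).re, (z j).im]

/-- The coordinate vector of `ℝⁿ ⊗ ℝ³` along the `a`-th coordinate of `𝐱ⱼ`. -/
def r3unit (a : Fin 3) (j : Fin n) : R3n n := Pi.single j (EuclideanSpace.single a 1)

/-- The conditions on a function `F` on `D ⊆ ℝⁿ ⊗ ℝ³` under which the Legendre transform
construction applies to it. -/
structure IsLegendreFunction (D : Set (R3n n)) (F : R3n n → ℝ) : Prop where
  isOpen : IsOpen D
  smooth : ContDiffOn ℝ ∞ F D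
  /-- The three-dimensional Laplace equation for `𝐱 ↦ F (c₁ 𝐱, …, cₙ 𝐱)`, and for its translates. -/
  laplace : ∀ (c : Fin n → ℝ) (p : R3n n) (x : EuclideanSpace ℝ (Fin 3)),
    (p + fun j => c j • x) ∈ D →
      InnerProductSpace.HarmonicAt
        (fun x : EuclideanSpace ℝ (Fin 3) => F (p + fun j => c j • x)) x
  /-- The imaginary part of the system `∂²F/∂ξⱼ∂ξₖ + 4 ∂²F/∂zⱼ∂z̄ₖ = 0`, whose real part is the
  Laplace equation above. -/
  mixed : ∀ p ∈ D, ∀ j k : Fin n,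
    fderiv ℝ (fderiv ℝ F) p (r3unit 1 j) (r3unit 2 k)
      = fderiv ℝ (fderiv ℝ F) p (r3unit 2 j) (r3unit 1 k)
  /-- The matrix `∂²F/∂ξⱼ∂ξₖ` is invertible. -/
  nondeg : ∀ p ∈ D, ∀ a : Fin n → ℝ,
    (∀ j, ∑ k, fderiv ℝ (fderiv ℝ F) p (r3unit 0 j) (r3unit 0 k) * a k = 0) → a = 0
  /-- `ξ` can be recovered from `∂F/∂ξ` and `z`. -/
  inj : ∀ (ξ ξ' : Fin n → ℝ) (z : Fin n → ℂ), r3pt ξ z ∈ D → r3pt ξ' z ∈ D →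
    (∀ j, fderiv ℝ F (r3pt ξ z) (r3unit 0 j) = fderiv ℝ F (r3pt ξ' z) (r3unit 0 j)) → ξ = ξ'

/-- `ξ` is the Legendre dual variable of `(u, z)`: `∂F/∂ξⱼ (ξ, z) = uⱼ + ūⱼ` for all `j`. -/
def IsLegendreDual (D : Set (R3n n)) (F : R3n n → ℝ) (q : UZ n) (ξ : Fin n → ℝ) : Prop :=
  r3pt ξ q.2 ∈ D ∧ ∀ j, fderiv ℝ F (r3pt ξ q.2) (r3unit 0 j) = 2 * (q.1 j).re

/-- The manifold of the construction: all `(u, z)` for which there is a dual variable `ξ`. -/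
def legendreSpace (D : Set (R3n n)) (F : R3n n → ℝ) : Set (UZ n) :=
  {q | ∃ ξ, IsLegendreDual D F q ξ}

/-- The dual variable `ξ` as a function of `(u, z)`. -/
def legendreXi (D : Set (R3n n)) (F : R3n n → ℝ) (q : UZ n) : Fin n → ℝ :=
  Classical.epsilon (IsLegendreDual D F q)

/-- The Kähler potential `K = F - ∑ (uₖ + ūₖ) ξₖ` as a function of `(u, z)`. -/
def legendreK (D : Set (R3n n)) (F : R3n n → ℝ) (q : UZ n) : ℝ :=
  F (r3pt (legendreXi D F q) q.2) - ∑ k, 2 * (q.1 k).re * legendreXi D F q k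

/-- The real two-form `dd^c K = 2i ∂∂̄K`; in terms of second derivatives it is
`D²K (iA, B) - D²K (A, iB)`. -/
def ddc (K : UZ n → ℝ) (q : UZ n) : LinearMap.BilinForm ℝ (UZ n) :=
  LinearMap.mk₂ ℝ
    (fun A B => hessian K q (Complex.I • A) B - hessian K q A (Complex.I • B))
    (by intros; simp only [smul_add, map_add, add_apply]; ring)
    (by intros; simp only [smul_comm Complex.I, map_smul, smul_apply,
          smul_eq_mul]; ring)
    (by intros; simp only [smul_add, map_add]; ring)
    (by intros; simp only [smul_comm Complex.I, map_smul, smul_eq_mul]; ring)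

/-- The Kähler form of the construction, `ω₁ = -2i ∂∂̄K`.  The sign and the factor are those for
which `-½ ∂/∂(Im uⱼ)` has moment maps `ξⱼ` for `ω₁` and `zⱼ` for `ω₂ + i ω₃`. -/
def legendreOmega₁ (D : Set (R3n n)) (F : R3n n → ℝ) (q : UZ n) : LinearMap.BilinForm ℝ (UZ n) :=
  -ddc (legendreK D F) q

/-- The holomorphic symplectic form `2i ∑ duⱼ ∧ dzⱼ`, evaluated on `(A, B)`. -/
def duDz (A B : UZ n) : ℂ :=
  2 * Complex.I * ∑ j, (A.1 j * B.2 j - B.1 j * A.2 j)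

theorem duDz_add_left (A A' B : UZ n) : duDz (A + A') B = duDz A B + duDz A' B := by
  simp only [duDz, Prod.fst_add, Prod.snd_add, Pi.add_apply]
  rw [← mul_add, ← Finset.sum_add_distrib]
  congr 1; exact Finset.sum_congr rfl fun _ _ => by ring

theorem duDz_swap (A B : UZ n) : duDz A B = -duDz B A := by
  simp only [duDz]
  rw [← mul_neg, ← Finset.sum_neg_distrib]
  congr 1; exact Finset.sum_congr rfl fun _ _ => by ring

theorem duDz_smul_left (c : ℝ) (A B : UZ n) : duDz (c • A) B = c • duDz A B := by
  simp only [duDz, Prod.smul_fst, Prod.smul_snd, Pi.smul_apply, Complex.real_smul]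
  rw [mul_left_comm (c : ℂ), Finset.mul_sum (a := (c : ℂ))]
  congr 1; exact Finset.sum_congr rfl fun _ _ => by ring

/-- The real-bilinear, complex-valued form `2i ∑ duⱼ ∧ dzⱼ`. -/
def legendreOmegaC (n : ℕ) : UZ n →ₗ[ℝ] UZ n →ₗ[ℝ] ℂ :=
  LinearMap.mk₂ ℝ duDz duDz_add_left duDz_smul_left
    (fun A B B' => by rw [duDz_swap, duDz_add_left, duDz_swap B, duDz_swap B']; ring)
    (fun c A B => by rw [duDz_swap, duDz_smul_left, duDz_swap B, smul_neg, neg_neg])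

/-- `ω₂`, the real part of `2i ∑ duⱼ ∧ dzⱼ`. -/
def legendreOmega₂ (_q : UZ n) : LinearMap.BilinForm ℝ (UZ n) :=
  (legendreOmegaC n).compr₂ Complex.reLm

/-- `ω₃`, the imaginary part of `2i ∑ duⱼ ∧ dzⱼ`. -/
def legendreOmega₃ (_q : UZ n) : LinearMap.BilinForm ℝ (UZ n) :=
  (legendreOmegaC n).compr₂ Complex.imLm

/-- The Kähler metric of the construction, `(A, B) ↦ ω₁ (A, i B)`. -/
def legendreMetric (D : Set (R3n n)) (F : R3n n → ℝ) (q : UZ n) : LinearMap.BilinForm ℝ (UZ n) :=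
  LinearMap.mk₂ ℝ (fun A B => legendreOmega₁ D F q A (Complex.I • B))
    (by intros; simp only [map_add, LinearMap.add_apply])
    (by intros; simp only [map_smul, LinearMap.smul_apply])
    (by intros; simp only [smul_add, map_add])
    (by intros; simp only [smul_comm Complex.I, map_smul])

/-- The function `F (𝐱₁, …, 𝐱ₙ) = Re 𝓕 (ξ₁ + i s₁, …, ξₙ + i sₙ)`, where `ξⱼ` and `sⱼ` are the
first and the third coordinate of `𝐱ⱼ`. -/
def reF (𝓕 : (Fin n → ℂ) → ℂ) (p : R3n n) : ℝ :=
  (𝓕 fun j => (p j 0 : ℂ) + Complex.I * (p j 2 : ℂ)).re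

end Legendre

end

/-! ### Transport of hyperkähler structures along linear isomorphisms -/

section Transport

variable {P Q : Type*} [NormedAddCommGroup P] [NormedSpace ℝ P]
  [NormedAddCommGroup Q] [NormedSpace ℝ Q]

/-! Write `g` for the Hessian of `φ`, so `g(A, B) = Ω(A, I B)`. On `M × V` the form `ω₁` is closed
because the third derivatives of `φ` are symmetric, while `ω₂` and `ω₃` have constant coefficients.
The quaternionic structure is explicit: `J₁` is multiplication by `i` on `x + iy`, and `J₂`, `J₃`
are built from `I`.

The link with the Legendre transform is the pair of maps `v`, `w` from `M` to `ℂⁿ`. In a symplectic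
basis `dvⱼ(A) = Aⱼ - i (IA)ⱼ` and `dwⱼ(A) = (IA)ₙ₊ⱼ + i Aₙ₊ⱼ`, so both maps are holomorphic.
Compatibility of `I` with `Ω` says exactly that `∑ dvⱼ ∧ dwⱼ = 0`
(`IsSymplecticBasis.pairing_symm`). On vectors where `dw` is real, `Re ∑ dvⱼ dwⱼ` equals `g`;
positivity of `g` therefore makes `dw` injective, so `w` is a local chart. Near each point `∑ vⱼ
dwⱼ` is then a closed form in the chart `w`, and its primitive is the prepotential `𝓕`.

Given `𝓕`, the function `F = Re 𝓕(ξ + i Im z)` has `dF = Re ∑ vⱼ dwⱼ`. Its second derivatives are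
thus values of `Re ∑ dvⱼ dwⱼ` (`IsPrepotential.fderiv_reF_smooth`): harmonicity is `i² = -1`, and
invertibility of `F_ξξ` is positivity of `g`. Moreover `∂F/∂ξⱼ = Re vⱼ = xⱼ`, so with `uⱼ + ūⱼ = xⱼ`
the Legendre dual variable is `ξ(x)`, and `dK = Re ∑ vⱼ dwⱼ - d(∑ xⱼ ξⱼ) = -dφ`
(`IsPrepotential.hasFDerivAt_potentialOn`). Hence `-2i ∂∂̄K` has the coefficients of the Hessian of
`φ`, which is `ω₁`. The other two forms match by linear algebra, and the hyperkähler structure on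
`X_F` is carried over from `N × V` by the linear isomorphism `toUZ`. -/

theorem IsSymplecticForm.image {X : Set P} (hX : IsOpen X) {σ : P → LinearMap.BilinForm ℝ P}
    (h : IsSymplecticForm X σ) (Φ : P ≃L[ℝ] Q) {τ : Q → LinearMap.BilinForm ℝ Q}
    (hτ : ∀ p ∈ X, ∀ A B, τ (Φ p) (Φ A) (Φ B) = σ p A B) : IsSymplecticForm (Φ '' X) τ := by
  have hopen : IsOpen (Φ '' X) := Φ.toHomeomorph.isOpenMap X hX
  have hτ' : ∀ q ∈ Φ '' X, ∀ A B, τ q A B = σ (Φ.symm q) (Φ.symm A) (Φ.symm B) := by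
    rintro _ ⟨p, hp, rfl⟩ A B
    simpa using hτ p hp (Φ.symm A) (Φ.symm B)
  have hmaps : MapsTo Φ.symm (Φ '' X) X := by
    rintro _ ⟨p, hp, rfl⟩
    simpa using hp
  -- A linear map sends constant vector fields to constant ones, so the cyclic sum expressing
  -- closedness is transported term by term.
  have hfd : ∀ q ∈ Φ '' X, ∀ A B C, fderiv ℝ (fun q => τ q B C) q A
      = fderiv ℝ (fun p => σ p (Φ.symm B) (Φ.symm C)) (Φ.symm q) (Φ.symm A) := by
    intro q hq A B C
    have hev : (fun q => τ q B C)
        =ᶠ[nhds q] (fun p => σ p (Φ.symm B) (Φ.symm C)) ∘ Φ.symm := by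
      filter_upwards [hopen.mem_nhds hq] with r hr using hτ' r hr B C
    rw [hev.fderiv_eq, Φ.symm.comp_right_fderiv]
    rfl
  refine ⟨fun A B => ?_, fun q hq A => ?_, fun q hq A hA => ?_, fun q hq A B C => ?_⟩
  · exact ((h.smooth (Φ.symm A) (Φ.symm B)).comp Φ.symm.contDiff.contDiffOn hmaps).congr
      fun q hq => hτ' q hq A B
  · rw [hτ' q hq, h.alt _ (hmaps hq)]
  · have := h.nondeg _ (hmaps hq) (Φ.symm A) fun B => by
      simpa [hτ' q hq] using hA (Φ B)
    simpa using this
  · rw [hfd q hq, hfd q hq, hfd q hq]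
    exact h.closed _ (hmaps hq) _ _ _

theorem IsHyperkahler.image {X : Set P} {σ₁ σ₂ σ₃ G : P → LinearMap.BilinForm ℝ P}
    (h : IsHyperkahler X σ₁ σ₂ σ₃ G) (Φ : P ≃L[ℝ] Q)
    {τ₁ τ₂ τ₃ H : Q → LinearMap.BilinForm ℝ Q}
    (h₁ : ∀ p ∈ X, ∀ A B, τ₁ (Φ p) (Φ A) (Φ B) = σ₁ p A B)
    (h₂ : ∀ p ∈ X, ∀ A B, τ₂ (Φ p) (Φ A) (Φ B) = σ₂ p A B)
    (h₃ : ∀ p ∈ X, ∀ A B, τ₃ (Φ p) (Φ A) (Φ B) = σ₃ p A B)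
    (hH : ∀ p ∈ X, ∀ A B, H (Φ p) (Φ A) (Φ B) = G p A B) :
    IsHyperkahler (Φ '' X) τ₁ τ₂ τ₃ H := by
  have key : ∀ {τ σ : _}, (∀ A B, τ (Φ A) (Φ B) = σ A B) →
      ∀ A B, (τ : LinearMap.BilinForm ℝ Q) A B
        = (σ : LinearMap.BilinForm ℝ P) (Φ.symm A) (Φ.symm B) := by
    intro τ σ h A B
    simpa using h (Φ.symm A) (Φ.symm B)
  refine ⟨Φ.toHomeomorph.isOpenMap X h.isOpen, h.symplectic₁.image h.isOpen Φ h₁,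
    h.symplectic₂.image h.isOpen Φ h₂, h.symplectic₃.image h.isOpen Φ h₃, ?_, ?_, ?_⟩
  · rintro _ ⟨p, hp, rfl⟩ A B
    rw [key (hH p hp), key (hH p hp), h.metric_symm p hp]
  · rintro _ ⟨p, hp, rfl⟩ A hA
    rw [key (hH p hp)]
    exact h.metric_pos p hp _ (by simpa using hA)
  · rintro _ ⟨p, hp, rfl⟩
    obtain ⟨J₁, J₂, J₃, a1, a2, a3, b1, b2, b3, c1, c2, d1, d2, d3⟩ := h.quaternionic p hp
    let e : P ≃ₗ[ℝ] Q := Φ.toLinearEquiv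
    have he : ∀ (J : P →ₗ[ℝ] P) (A : Q), e.conj J A = Φ (J (Φ.symm A)) := fun _ _ => rfl
    refine ⟨e.conj J₁, e.conj J₂, e.conj J₃, ?_, ?_, ?_, ?_, ?_, ?_, ?_, ?_, ?_, ?_, ?_⟩
    · intro A B; rw [key (h₃ p hp), key (h₂ p hp), he]; simpa using a1 _ _
    · intro A B; rw [key (h₁ p hp), key (h₃ p hp), he]; simpa using a2 _ _
    · intro A B; rw [key (h₂ p hp), key (h₁ p hp), he]; simpa using a3 _ _
    · intro A; simp [he, b1]
    · intro A; simp [he, b2]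
    · intro A; simp [he, b3]
    · intro A; simp [he, c1]
    · intro A; simp [he, c2]
    · intro A B; rw [key (h₁ p hp), key (hH p hp), he]; simpa using d1 _ _
    · intro A B; rw [key (h₂ p hp), key (hH p hp), he]; simpa using d2 _ _
    · intro A B; rw [key (h₃ p hp), key (hH p hp), he]; simpa using d3 _ _

end Transport

/-! ### The potential of a special Kähler structure -/

section Potential

variable {n : ℕ} {V : Type*} [NormedAddCommGroup V] [NormedSpace ℝ V]
  {Ω : LinearMap.BilinForm ℝ V} {M : Set V} {I : V → V →L[ℝ] V} {φ : V → ℝ}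

theorem IsSpecialKahler.apply_map_left (hM : IsSpecialKahler Ω M I) {x : V} (hx : x ∈ M)
    (A B : V) : Ω (I x A) B = -Ω A (I x B) := by
  have := hM.compatible x hx A (I x B)
  rw [hM.sq x hx, map_neg] at this
  linarith

theorem IsSpecialKahler.mono {N : Set V} (hM : IsSpecialKahler Ω M I) (hN : IsOpen N) (hNM : N ⊆ M) :
    IsSpecialKahler Ω N I :=
  ⟨hN, hM.alt, hM.nondeg, hM.smooth.mono hNM, fun x hx => hM.sq x (hNM hx),
    fun x hx => hM.d_nabla x (hNM hx), fun x hx => hM.compatible x (hNM hx),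
    fun x hx => hM.pos x (hNM hx)⟩

theorem IsSpecialPotential.mono {N : Set V} (hφ : IsSpecialPotential Ω M I φ) (hNM : N ⊆ M) :
    IsSpecialPotential Ω N I φ :=
  ⟨hφ.smooth.mono hNM, fun x hx => hφ.hessian_eq x (hNM hx)⟩

theorem IsSpecialPotential.fderiv_contDiffOn (hφ : IsSpecialPotential Ω M I φ) (hM : IsOpen M) :
    ContDiffOn ℝ ∞ (fderiv ℝ φ) M :=
  hφ.smooth.fderiv_of_isOpen hM (by simp)

theorem IsSpecialPotential.hessian_contDiffOn (hφ : IsSpecialPotential Ω M I φ) (hM : IsOpen M) :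
    ContDiffOn ℝ ∞ (hessian φ) M :=
  (hφ.fderiv_contDiffOn hM).fderiv_of_isOpen hM (by simp)

theorem IsSpecialPotential.hessian_symm (hφ : IsSpecialPotential Ω M I φ) (hM : IsOpen M)
    {x : V} (hx : x ∈ M) (A B : V) : hessian φ x A B = hessian φ x B A :=
  ((hφ.smooth.contDiffAt (hM.mem_nhds hx)).isSymmSndFDerivAt (n := ∞)
    (by simpa using ENat.LEInfty.out)) A B

theorem IsSpecialPotential.differentiableAt (hφ : IsSpecialPotential Ω M I φ) (hM : IsOpen M)
    {x : V} (hx : x ∈ M) : DifferentiableAt ℝ φ x :=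
  (hφ.smooth.contDiffAt (hM.mem_nhds hx)).differentiableAt (by simp)

theorem IsSpecialPotential.fderiv_differentiableAt (hφ : IsSpecialPotential Ω M I φ)
    (hM : IsOpen M) {x : V} (hx : x ∈ M) : DifferentiableAt ℝ (fderiv ℝ φ) x :=
  ((hφ.fderiv_contDiffOn hM).contDiffAt (hM.mem_nhds hx)).differentiableAt (by simp)

theorem IsSpecialPotential.hessian_differentiableAt (hφ : IsSpecialPotential Ω M I φ)
    (hM : IsOpen M) {x : V} (hx : x ∈ M) : DifferentiableAt ℝ (hessian φ) x :=
  ((hφ.hessian_contDiffOn hM).contDiffAt (hM.mem_nhds hx)).differentiableAt (by simp)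

theorem IsSpecialPotential.hasFDerivAt_hessian_apply (hφ : IsSpecialPotential Ω M I φ)
    (hM : IsOpen M) {x : V} (hx : x ∈ M) (B C : V) :
    HasFDerivAt (fun y => hessian φ y B C) (((fderiv ℝ (hessian φ) x).flip B).flip C) x := by
  have h := ((hφ.hessian_differentiableAt hM hx).hasFDerivAt.clm_apply
    (hasFDerivAt_const B x)).clm_apply (hasFDerivAt_const C x)
  simpa using h

/-- The third derivatives of the potential are symmetric in the first two arguments. -/
theorem IsSpecialPotential.third_symm_left (hφ : IsSpecialPotential Ω M I φ) (hM : IsOpen M)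
    {x : V} (hx : x ∈ M) (A B C : V) :
    fderiv ℝ (hessian φ) x A B C = fderiv ℝ (hessian φ) x B A C :=
  congrArg (fun L : V →L[ℝ] ℝ => L C)
    ((((hφ.fderiv_contDiffOn hM).contDiffAt (hM.mem_nhds hx)).isSymmSndFDerivAt (n := ∞)
    (by simpa using ENat.LEInfty.out)) A B)

/-! ### The hyperkähler triple on `M × V` -/

theorem cfgOmega₁_apply (φ : V → ℝ) (p A B : V × V) :
    cfgOmega₁ φ p A B = hessian φ p.1 A.1 B.2 - hessian φ p.1 B.1 A.2 := rfl

theorem cfgOmega₂_apply (Ω : LinearMap.BilinForm ℝ V) (p A B : V × V) :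
    cfgOmega₂ Ω p A B = -(Ω A.1 B.1 - Ω A.2 B.2) := rfl

theorem cfgOmega₃_apply (Ω : LinearMap.BilinForm ℝ V) (p A B : V × V) :
    cfgOmega₃ Ω p A B = -(Ω A.1 B.2 + Ω A.2 B.1) := rfl

theorem cfgMetric_apply (φ : V → ℝ) (p A B : V × V) :
    cfgMetric φ p A B = hessian φ p.1 A.1 B.1 + hessian φ p.1 A.2 B.2 := rfl

theorem IsSpecialPotential.isSymplecticForm_cfgOmega₁ (hφ : IsSpecialPotential Ω M I φ)
    (hM : IsSpecialKahler Ω M I) :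
    IsSymplecticForm (M ×ˢ (univ : Set V)) (cfgOmega₁ φ) := by
  have hpos : ∀ x ∈ M, ∀ A : V, hessian φ x A A = 0 → A = 0 := by
    intro x hx A hA
    by_contra hne
    have := hM.pos x hx A hne
    rw [hφ.hessian_eq x hx] at hA
    exact this.ne' hA
  have hc : ∀ A B : V, ContDiffOn ℝ ∞ (fun p : V × V => hessian φ p.1 A B)
      (M ×ˢ (univ : Set V)) := fun A B =>
    (((hφ.hessian_contDiffOn hM.isOpen).comp contDiff_fst.contDiffOn
      fun p hp => hp.1).clm_apply contDiffOn_const).clm_apply contDiffOn_const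
  refine ⟨fun A B => (hc A.1 B.2).sub (hc B.1 A.2), fun p hp A => ?_, fun p hp A hA => ?_, ?_⟩
  · rw [cfgOmega₁_apply, sub_self]
  -- These two test vectors give `g(A₁, A₁) = 0` and `g(A₂, A₂) = 0`, so nondegeneracy follows from
  -- positivity of `g`.
  · have h1 := hA (0, A.1)
    have h2 := hA (A.2, 0)
    simp only [cfgOmega₁_apply, map_zero, zero_apply] at h1 h2
    exact Prod.ext (hpos p.1 hp.1 _ (by simpa using h1)) (hpos p.1 hp.1 _ (by simpa using h2))
  · rintro p ⟨hp, -⟩ A B C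
    have hfd : ∀ A B C : V × V, fderiv ℝ (fun q => cfgOmega₁ φ q B C) p A
        = fderiv ℝ (hessian φ) p.1 A.1 B.1 C.2 - fderiv ℝ (hessian φ) p.1 A.1 C.1 B.2 := by
      intro A B C
      have h₁ : HasFDerivAt (Prod.fst : V × V → V) (ContinuousLinearMap.fst ℝ V V) p :=
        hasFDerivAt_fst
      have h := ((hφ.hasFDerivAt_hessian_apply hM.isOpen hp B.1 C.2).comp p h₁).sub
        ((hφ.hasFDerivAt_hessian_apply hM.isOpen hp C.1 B.2).comp p h₁)
      have h' : HasFDerivAt (fun q => cfgOmega₁ φ q B C) _ p := h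
      rw [h'.fderiv]
      simp
    -- The cyclic sum has six third derivatives of `φ`; exchanging their first two arguments makes
    -- them cancel in pairs.
    rw [hfd, hfd, hfd, hφ.third_symm_left hM.isOpen hp A.1 B.1, hφ.third_symm_left hM.isOpen hp
      B.1 C.1, hφ.third_symm_left hM.isOpen hp C.1 A.1]
    ring

theorem IsSpecialKahler.eq_zero_of_forall (hM : IsSpecialKahler Ω M I) {A : V}
    (hA : ∀ B, Ω A B = 0) : A = 0 := hM.nondeg.1 A hA

theorem IsSpecialKahler.isSymplecticForm_cfgOmega₂ (hM : IsSpecialKahler Ω M I) :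
    IsSymplecticForm (M ×ˢ (univ : Set V)) (cfgOmega₂ Ω) := by
  refine ⟨fun A B => contDiffOn_const, fun p _ A => ?_, fun p _ A hA => ?_, fun p _ A B C => ?_⟩
  · simp [cfgOmega₂_apply, hM.alt A.1, hM.alt A.2]
  · exact Prod.ext (hM.eq_zero_of_forall fun B => by simpa [cfgOmega₂_apply] using hA (B, 0))
      (hM.eq_zero_of_forall fun B => by simpa [cfgOmega₂_apply] using hA (0, B))
  · simp [cfgOmega₂_apply]

theorem IsSpecialKahler.isSymplecticForm_cfgOmega₃ (hM : IsSpecialKahler Ω M I) :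
    IsSymplecticForm (M ×ˢ (univ : Set V)) (cfgOmega₃ Ω) := by
  refine ⟨fun A B => contDiffOn_const, fun p _ A => ?_, fun p _ A hA => ?_, fun p _ A B C => ?_⟩
  · rw [cfgOmega₃_apply, ← LinearMap.IsAlt.neg hM.alt A.1 A.2]; ring
  · exact Prod.ext (hM.eq_zero_of_forall fun B => by simpa [cfgOmega₃_apply] using hA (0, B))
      (hM.eq_zero_of_forall fun B => by simpa [cfgOmega₃_apply] using hA (B, 0))
  · simp [cfgOmega₃_apply]

theorem IsSpecialPotential.isHyperkahler (hφ : IsSpecialPotential Ω M I φ)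
    (hM : IsSpecialKahler Ω M I) :
    IsHyperkahler (M ×ˢ (univ : Set V)) (cfgOmega₁ φ) (cfgOmega₂ Ω) (cfgOmega₃ Ω)
      (cfgMetric φ) := by
  refine ⟨hM.isOpen.prod isOpen_univ, hφ.isSymplecticForm_cfgOmega₁ hM,
    hM.isSymplecticForm_cfgOmega₂, hM.isSymplecticForm_cfgOmega₃, ?_, ?_, ?_⟩
  · rintro p ⟨hp, -⟩ A B
    rw [cfgMetric_apply, cfgMetric_apply, hφ.hessian_symm hM.isOpen hp A.1,
      hφ.hessian_symm hM.isOpen hp A.2]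
  · rintro p ⟨hp, -⟩ A hA
    have hnn : ∀ C, 0 ≤ Ω C (I p.1 C) := by
      intro C
      rcases eq_or_ne C 0 with rfl | hC
      · simp
      · exact (hM.pos p.1 hp C hC).le
    rw [cfgMetric_apply, hφ.hessian_eq _ hp, hφ.hessian_eq _ hp]
    rcases eq_or_ne A.1 0 with h1 | h1
    · have h2 : A.2 ≠ 0 := fun h2 => hA (Prod.ext h1 h2)
      linarith [hnn A.1, hM.pos p.1 hp _ h2]
    · linarith [hnn A.2, hM.pos p.1 hp _ h1]
  · rintro p ⟨hp, -⟩
    have hI := hM.apply_map_left hp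
    have hsq := hM.sq _ hp
    have hg := hφ.hessian_eq _ hp
    have hs : ∀ A B, Ω A (I p.1 B) = Ω B (I p.1 A) := fun A B => by
      rw [← hg, ← hg, hφ.hessian_symm hM.isOpen hp]
    have hn : ∀ A B, Ω A B = -Ω B A := fun A B => (LinearMap.IsAlt.neg hM.alt B A).symm
    let i : V →ₗ[ℝ] V := (I p.1 : V →ₗ[ℝ] V)
    let π₁ := LinearMap.fst ℝ V V
    let π₂ := LinearMap.snd ℝ V V
    -- Solving `ω₃(J₁ ·, ·) = ω₂` and its cyclic analogues gives `J₁(A₁, A₂) = (-A₂, A₁)`, `J₂(A₁,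
    -- A₂) = (-I A₁, I A₂)` and `J₃(A₁, A₂) = (-I A₂, -I A₁)`.
    refine ⟨(-π₂).prod π₁, (-(i ∘ₗ π₁)).prod (i ∘ₗ π₂), (-(i ∘ₗ π₂)).prod (-(i ∘ₗ π₁)),
      ?_, ?_, ?_, ?_, ?_, ?_, ?_, ?_, ?_, ?_, ?_⟩
    · intro A B
      simp [cfgOmega₃_apply, cfgOmega₂_apply, π₁, π₂]; ring
    · intro A B
      simp [cfgOmega₁_apply, cfgOmega₃_apply, π₁, π₂, i, hg, hI, hsq]
      rw [hn A.2]; ring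
    · intro A B
      simp [cfgOmega₁_apply, cfgOmega₂_apply, π₁, π₂, i, hg, hI]
      rw [hs A.2]
    · intro A; ext <;> simp [π₁, π₂]
    · intro A; ext <;> simp [π₁, π₂, i, hsq]
    · intro A; ext <;> simp [π₁, π₂, i, hsq]
    · intro A; ext <;> simp [π₁, π₂, i, hsq]
    · intro A; ext <;> simp [π₁, π₂, i, hsq]
    · intro A B
      simp [cfgOmega₁_apply, cfgMetric_apply, π₁, π₂, hg]
      rw [hs A.2]
    · intro A B
      simp [cfgOmega₂_apply, cfgMetric_apply, π₁, π₂, i, hg]; ring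
    · intro A B
      simp [cfgOmega₃_apply, cfgMetric_apply, π₁, π₂, i, hg]; ring

end Potential

/-! ### Inverse functions -/

/-- Near `f x` any left inverse on `N` coincides with the local inverse of the inverse function
theorem, and so inherits its smoothness and derivative. -/
theorem ContDiffOn.leftInverse_contDiffAt {E F : Type*} [NormedAddCommGroup E] [NormedSpace ℝ E]
    [CompleteSpace E] [NormedAddCommGroup F] [NormedSpace ℝ F] {f : E → F} {g : F → E} {N : Set E}
    (hf : ContDiffOn ℝ ∞ f N) (hN : IsOpen N) (hg : LeftInvOn g f N) {x : E} (hx : x ∈ N)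
    {f' : E ≃L[ℝ] F} (hf' : HasFDerivAt f (f' : E →L[ℝ] F) x) :
    ContDiffAt ℝ ∞ g (f x) ∧ HasFDerivAt g (f'.symm : F →L[ℝ] E) (f x) := by
  have hc := hf.contDiffAt (hN.mem_nhds hx)
  have hs := hc.hasStrictFDerivAt' hf' (by simp)
  have hev : ∀ᶠ y in nhds x, g (f y) = y := by
    filter_upwards [hN.mem_nhds hx] with y hy using hg hy
  exact ⟨(hc.to_localInverse hf' (by simp)).congr_of_eventuallyEq (hs.localInverse_unique hev),
    (hs.to_local_left_inverse hev).hasFDerivAt⟩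

/-! ### Symplectic bases -/

section SymplecticBasis

variable {n : ℕ} {V : Type*} [NormedAddCommGroup V] [NormedSpace ℝ V]
  {Ω : LinearMap.BilinForm ℝ V} {b : Module.Basis (Fin n ⊕ Fin n) ℝ V}

theorem IsSymplecticBasis.inr_inl (hb : IsSymplecticBasis Ω b) (hΩ : Ω.IsAlt) (i j : Fin n) :
    Ω (b (Sum.inr i)) (b (Sum.inl j)) = if i = j then -1 else 0 := by
  rw [← LinearMap.IsAlt.neg hΩ, hb.inl_inr]
  by_cases h : i = j
  · simp [h]
  · simp [h, Ne.symm h]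

theorem IsSymplecticBasis.apply_inl (hb : IsSymplecticBasis Ω b) (j : Fin n) (A : V) :
    Ω (b (Sum.inl j)) A = b.repr A (Sum.inr j) := by
  conv_lhs => rw [← b.sum_repr A, Fintype.sum_sum_type]
  simp only [map_add, map_sum, map_smul, hb.inl_inl, hb.inl_inr]
  simp

theorem IsSymplecticBasis.apply_inr (hb : IsSymplecticBasis Ω b) (hΩ : Ω.IsAlt) (j : Fin n)
    (A : V) : Ω (b (Sum.inr j)) A = -b.repr A (Sum.inl j) := by
  conv_lhs => rw [← b.sum_repr A, Fintype.sum_sum_type]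
  simp only [map_add, map_sum, map_smul, hb.inr_inr, hb.inr_inl hΩ]
  simp

theorem IsSymplecticBasis.apply_eq_sum (hb : IsSymplecticBasis Ω b) (hΩ : Ω.IsAlt) (A B : V) :
    Ω A B = ∑ j, (b.repr A (Sum.inl j) * b.repr B (Sum.inr j)
      - b.repr A (Sum.inr j) * b.repr B (Sum.inl j)) := by
  conv_lhs => rw [← b.sum_repr A, Fintype.sum_sum_type]
  simp only [map_add, map_sum, map_smul, LinearMap.add_apply, LinearMap.sum_apply,
    LinearMap.smul_apply, smul_eq_mul, hb.apply_inl, hb.apply_inr hΩ, Finset.sum_add_distrib,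
    mul_neg, Finset.sum_neg_distrib, sub_eq_add_neg]

variable {M : Set V} {I : V → V →L[ℝ] V} {φ : V → ℝ}

theorem IsSpecialPotential.hasFDerivAt_xi (hφ : IsSpecialPotential Ω M I φ) (hM : IsOpen M)
    {x : V} (hx : x ∈ M) (k : Fin n ⊕ Fin n) :
    HasFDerivAt (fun y => xi b φ k y) ((hessian φ x).flip (b k)) x := by
  unfold xi
  have h := (hφ.fderiv_differentiableAt hM hx).hasFDerivAt.clm_apply (hasFDerivAt_const (b k) x)
  simpa [hessian] using h

theorem IsSpecialPotential.xi_contDiffOn (hφ : IsSpecialPotential Ω M I φ) (hM : IsOpen M)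
    (k : Fin n ⊕ Fin n) : ContDiffOn ℝ ∞ (xi b φ k) M :=
  (hφ.fderiv_contDiffOn hM).clm_apply contDiffOn_const

theorem IsSymplecticBasis.hessian_inl (hb : IsSymplecticBasis Ω b) (hM : IsSpecialKahler Ω M I)
    (hφ : IsSpecialPotential Ω M I φ) {x : V} (hx : x ∈ M) (A : V) (j : Fin n) :
    hessian φ x A (b (Sum.inl j)) = b.repr (I x A) (Sum.inr j) := by
  rw [hφ.hessian_symm hM.isOpen hx, hφ.hessian_eq x hx, hb.apply_inl]

theorem IsSymplecticBasis.hessian_inr (hb : IsSymplecticBasis Ω b) (hM : IsSpecialKahler Ω M I)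
    (hφ : IsSpecialPotential Ω M I φ) {x : V} (hx : x ∈ M) (A : V) (j : Fin n) :
    hessian φ x A (b (Sum.inr j)) = -b.repr (I x A) (Sum.inl j) := by
  rw [hφ.hessian_symm hM.isOpen hx, hφ.hessian_eq x hx, hb.apply_inr hM.alt]

theorem fderiv_apply_eq_sum_xi (b : Module.Basis (Fin n ⊕ Fin n) ℝ V) (φ : V → ℝ) (x A : V) :
    fderiv ℝ φ x A = ∑ j, (b.repr A (Sum.inl j) * xi b φ (Sum.inl j) x
      + b.repr A (Sum.inr j) * xi b φ (Sum.inr j) x) := by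
  conv_lhs => rw [← b.sum_repr A, Fintype.sum_sum_type]
  simp only [map_add, map_sum, map_smul, smul_eq_mul, Finset.sum_add_distrib, xi]

end SymplecticBasis

/-! ### The holomorphic coordinates `v` and `w` -/

section Coordinates

variable {n : ℕ} {V : Type*} [NormedAddCommGroup V] [NormedSpace ℝ V] [FiniteDimensional ℝ V]

/-- The coordinates of a basis as continuous linear forms. -/
noncomputable def coordCLM {ι : Type*} (b : Module.Basis ι ℝ V) (k : ι) : V →L[ℝ] ℝ :=
  LinearMap.toContinuousLinearMap (b.coord k)

@[simp] theorem coordCLM_apply {ι : Type*} (b : Module.Basis ι ℝ V) (k : ι) (A : V) :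
    coordCLM b k A = b.repr A k := rfl

variable (b : Module.Basis (Fin n ⊕ Fin n) ℝ V) (φ : V → ℝ)

/-- The differential of `v`. -/
noncomputable def vDeriv (x : V) : V →L[ℝ] (Fin n → ℂ) :=
  ContinuousLinearMap.pi fun j => Complex.ofRealCLM.comp (coordCLM b (Sum.inl j))
    + Complex.I • Complex.ofRealCLM.comp ((hessian φ x).flip (b (Sum.inr j)))

/-- The differential of `w`. -/
noncomputable def wDeriv (x : V) : V →L[ℝ] (Fin n → ℂ) :=
  ContinuousLinearMap.pi fun j => Complex.ofRealCLM.comp ((hessian φ x).flip (b (Sum.inl j)))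
    + Complex.I • Complex.ofRealCLM.comp (coordCLM b (Sum.inr j))

theorem vDeriv_apply (x A : V) (j : Fin n) : vDeriv b φ x A j
    = (b.repr A (Sum.inl j) : ℂ) + Complex.I * (hessian φ x A (b (Sum.inr j)) : ℂ) := rfl

theorem wDeriv_apply (x A : V) (j : Fin n) : wDeriv b φ x A j
    = (hessian φ x A (b (Sum.inl j)) : ℂ) + Complex.I * (b.repr A (Sum.inr j) : ℂ) := rfl

/-- The complex bilinear pairing `∑ aⱼ bⱼ` of `ℂⁿ`, as a map into the complex linear forms. -/
noncomputable def pairing (n : ℕ) : (Fin n → ℂ) →L[ℝ] (Fin n → ℂ) →L[ℂ] ℂ :=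
  LinearMap.toContinuousLinearMap
    { toFun := fun v => ∑ j, v j • (ContinuousLinearMap.proj j : (Fin n → ℂ) →L[ℂ] ℂ)
      map_add' := fun v v' => ContinuousLinearMap.ext fun w => by
        simp [add_mul, Finset.sum_add_distrib]
      map_smul' := fun c v => ContinuousLinearMap.ext fun w => by
        simp [Finset.mul_sum, mul_assoc] }

theorem pairing_apply (v w : Fin n → ℂ) : pairing n v w = ∑ j, v j * w j := by
  simp [pairing]

theorem pairing_single (v : Fin n → ℂ) (j : Fin n) : pairing n v (Pi.single j 1) = v j := by
  simp [pairing_apply, Pi.single_apply]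

theorem eq_pairing_of_single {L : (Fin n → ℂ) →L[ℂ] ℂ} {v : Fin n → ℂ}
    (h : ∀ j, v j = L (Pi.single j 1)) : L = pairing n v := by
  refine ContinuousLinearMap.coe_injective ((Pi.basisFun ℂ (Fin n)).ext fun j => ?_)
  simp [pairing_single, h j]

variable {b φ} {Ω : LinearMap.BilinForm ℝ V} {M : Set V} {I : V → V →L[ℝ] V}

theorem IsSpecialPotential.hasFDerivAt_vCoord (hφ : IsSpecialPotential Ω M I φ) (hM : IsOpen M)
    {x : V} (hx : x ∈ M) : HasFDerivAt (vCoord b φ) (vDeriv b φ x) x := by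
  refine hasFDerivAt_pi.2 fun j => ?_
  exact (Complex.ofRealCLM.hasFDerivAt.comp x (coordCLM b (Sum.inl j)).hasFDerivAt).add
    ((Complex.ofRealCLM.hasFDerivAt.comp x
      (hφ.hasFDerivAt_xi hM hx (Sum.inr j))).const_mul Complex.I)

theorem IsSpecialPotential.hasFDerivAt_wCoord (hφ : IsSpecialPotential Ω M I φ) (hM : IsOpen M)
    {x : V} (hx : x ∈ M) : HasFDerivAt (wCoord b φ) (wDeriv b φ x) x := by
  refine hasFDerivAt_pi.2 fun j => ?_
  exact (Complex.ofRealCLM.hasFDerivAt.comp x (hφ.hasFDerivAt_xi hM hx (Sum.inl j))).add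
    ((Complex.ofRealCLM.hasFDerivAt.comp x
      (coordCLM b (Sum.inr j)).hasFDerivAt).const_mul Complex.I)

theorem IsSpecialPotential.vCoord_contDiffOn (hφ : IsSpecialPotential Ω M I φ) (hM : IsOpen M) :
    ContDiffOn ℝ ∞ (vCoord b φ) M := by
  refine contDiffOn_pi.2 fun j => ?_
  exact (Complex.ofRealCLM.contDiff.comp (coordCLM b (Sum.inl j)).contDiff).contDiffOn.add
    (contDiffOn_const.mul (Complex.ofRealCLM.contDiff.comp_contDiffOn
      (hφ.xi_contDiffOn hM (Sum.inr j))))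

theorem IsSpecialPotential.wCoord_contDiffOn (hφ : IsSpecialPotential Ω M I φ) (hM : IsOpen M) :
    ContDiffOn ℝ ∞ (wCoord b φ) M := by
  refine contDiffOn_pi.2 fun j => ?_
  exact (Complex.ofRealCLM.contDiff.comp_contDiffOn (hφ.xi_contDiffOn hM (Sum.inl j))).add
    (contDiff_const.mul
      (Complex.ofRealCLM.contDiff.comp (coordCLM b (Sum.inr j)).contDiff)).contDiffOn

/-! ### Linear algebra of `dv` and `dw` at a point -/

section Linear

variable (hM : IsSpecialKahler Ω M I) (hφ : IsSpecialPotential Ω M I φ)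
  (hb : IsSymplecticBasis Ω b) {x : V} (hx : x ∈ M)

include hM hφ hb hx

/-- Holomorphy of `w`: since `dwⱼ(A) = (IA)ₙ₊ⱼ + i Aₙ₊ⱼ`, replacing `A` by `IA` multiplies by `i`.
-/
theorem IsSymplecticBasis.wDeriv_map (A : V) :
    wDeriv b φ x (I x A) = Complex.I • wDeriv b φ x A := by
  ext j
  simp only [wDeriv_apply, Pi.smul_apply, smul_eq_mul, hb.hessian_inl hM hφ hx, hM.sq x hx]
  apply Complex.ext <;> simp

/-- The real part of `∑ dvⱼ(A) dwⱼ(B)`. -/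
theorem IsSymplecticBasis.re_pairing (A B : V) :
    (pairing n (vDeriv b φ x A) (wDeriv b φ x B)).re
      = ∑ j, (b.repr A (Sum.inl j) * b.repr (I x B) (Sum.inr j)
        + b.repr (I x A) (Sum.inl j) * b.repr B (Sum.inr j)) := by
  simp only [pairing_apply, vDeriv_apply, wDeriv_apply, hb.hessian_inl hM hφ hx,
    hb.hessian_inr hM hφ hx, Complex.re_sum]
  refine Finset.sum_congr rfl fun j _ => ?_
  simp

/-- The imaginary part of `∑ dvⱼ(A) dwⱼ(B)`. -/
theorem IsSymplecticBasis.im_pairing (A B : V) :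
    (pairing n (vDeriv b φ x A) (wDeriv b φ x B)).im
      = ∑ j, (b.repr A (Sum.inl j) * b.repr B (Sum.inr j)
        - b.repr (I x A) (Sum.inl j) * b.repr (I x B) (Sum.inr j)) := by
  simp only [pairing_apply, vDeriv_apply, wDeriv_apply, hb.hessian_inl hM hφ hx,
    hb.hessian_inr hM hφ hx, Complex.im_sum]
  refine Finset.sum_congr rfl fun j _ => ?_
  simp [sub_eq_add_neg]

/-- The form `∑ dvⱼ ∧ dwⱼ` vanishes on `M`. -/
theorem IsSymplecticBasis.pairing_symm (A B : V) :
    pairing n (vDeriv b φ x A) (wDeriv b φ x B) = pairing n (vDeriv b φ x B) (wDeriv b φ x A) := by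
  -- Antisymmetrising the pairing in `A`, `B` gives real part `Ω(A, IB) + Ω(IA, B)` and imaginary
  -- part `Ω(A, B) - Ω(IA, IB)`; both vanish.
  have h1 := hM.apply_map_left hx A B
  have h2 := hM.compatible x hx A B
  simp only [hb.apply_eq_sum hM.alt, Finset.sum_sub_distrib] at h1 h2
  apply Complex.ext
  · simp only [hb.re_pairing hM hφ hx, Finset.sum_add_distrib]
    simp only [mul_comm (b.repr B _), mul_comm (b.repr (I x B) _)]
    linarith
  · simp only [hb.im_pairing hM hφ hx, Finset.sum_sub_distrib]
    simp only [mul_comm (b.repr B _), mul_comm (b.repr (I x B) _)]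
    linarith

/-- Both `dv` and `dw` are complex linear for `I`, so the sign is `i² = -1`. This is what makes `F`
harmonic. -/
theorem IsSymplecticBasis.re_pairing_map (A : V) :
    (pairing n (vDeriv b φ x (I x A)) (wDeriv b φ x (I x A))).re
      = -(pairing n (vDeriv b φ x A) (wDeriv b φ x A)).re := by
  simp only [hb.re_pairing hM hφ hx, hM.sq x hx, map_neg, Finsupp.neg_apply,
    ← Finset.sum_neg_distrib]
  exact Finset.sum_congr rfl fun j _ => by ring

/-- On vectors on which `dw` is real, `Re ∑ dvⱼ dwⱼ` is the Kähler metric. -/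
theorem IsSymplecticBasis.re_pairing_of_real {A : V} (hA : ∀ j, (wDeriv b φ x A j).im = 0) :
    (pairing n (vDeriv b φ x A) (wDeriv b φ x A)).re = Ω A (I x A) := by
  have h : ∀ j, b.repr A (Sum.inr j) = 0 := fun j => by simpa [wDeriv_apply] using hA j
  rw [hb.re_pairing hM hφ hx, hb.apply_eq_sum hM.alt]
  simp [h]

/-- If `dw(A) = 0`, then `dw(A)` is in particular real, so `g(A, A)` equals a pairing with zero. -/
theorem IsSymplecticBasis.wDeriv_injective : Function.Injective (wDeriv b φ x) := by
  rw [injective_iff_map_eq_zero]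
  intro A hA
  have h := hb.re_pairing_of_real hM hφ hx (A := A) fun j => by simp [hA]
  rw [hA, map_zero] at h
  by_contra hne
  exact (hM.pos x hx A hne).ne h

theorem IsSymplecticBasis.exists_wDeriv_equiv :
    ∃ e : V ≃L[ℝ] (Fin n → ℂ), (e : V →L[ℝ] (Fin n → ℂ)) = wDeriv b φ x := by
  have hdim : Module.finrank ℝ V = Module.finrank ℝ (Fin n → ℂ) := by
    rw [Module.finrank_eq_card_basis b, Module.finrank_pi_fintype]
    simp [Complex.finrank_real_complex, mul_two]
  have hinj := hb.wDeriv_injective hM hφ hx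
  exact ⟨(LinearMap.linearEquivOfInjective (wDeriv b φ x : V →ₗ[ℝ] (Fin n → ℂ)) hinj
    hdim).toContinuousLinearEquiv, by ext; rfl⟩

end Linear

/-- The inverse of `w` on an open set where it is injective. -/
theorem IsSymplecticBasis.leftInverse_wCoord (hb : IsSymplecticBasis Ω b)
    (hM : IsSpecialKahler Ω M I) (hφ : IsSpecialPotential Ω M I φ) {N : Set V} (hN : IsOpen N)
    (hNM : N ⊆ M) {ψ : (Fin n → ℂ) → V} (hψ : LeftInvOn ψ (wCoord b φ) N) {x : V} (hx : x ∈ N) :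
    ContDiffAt ℝ ∞ ψ (wCoord b φ x) ∧ DifferentiableAt ℝ ψ (wCoord b φ x) ∧
      ∀ a, wDeriv b φ x (fderiv ℝ ψ (wCoord b φ x) a) = a := by
  obtain ⟨e, he⟩ := hb.exists_wDeriv_equiv hM hφ (hNM hx)
  have hd := hφ.hasFDerivAt_wCoord (b := b) hM.isOpen (hNM hx)
  rw [← he] at hd
  obtain ⟨h1, h2⟩ := ((hφ.wCoord_contDiffOn hM.isOpen).mono hNM).leftInverse_contDiffAt hN hψ hx hd
  refine ⟨h1, h2.differentiableAt, fun a => ?_⟩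
  rw [h2.fderiv, ← he]
  simp

/-- The form `∑ vⱼ dwⱼ`, read in the chart `w`, is closed by `IsSymplecticBasis.pairing_symm`. Its
values are complex linear forms, so the primitive given by the Poincaré lemma is holomorphic. -/
theorem IsSymplecticBasis.exists_prepotential (hb : IsSymplecticBasis Ω b)
    (hM : IsSpecialKahler Ω M I) (hφ : IsSpecialPotential Ω M I φ) {x : V} (hx : x ∈ M) :
    ∃ N ⊆ M, IsOpen N ∧ x ∈ N ∧ ∃ 𝓕, IsPrepotential b φ N 𝓕 := by
  obtain ⟨e, he⟩ := hb.exists_wDeriv_equiv hM hφ hx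
  have hd := hφ.hasFDerivAt_wCoord (b := b) hM.isOpen hx
  rw [← he] at hd
  have hc := (hφ.wCoord_contDiffOn (b := b) hM.isOpen).contDiffAt (hM.isOpen.mem_nhds hx)
  let h := hc.toOpenPartialHomeomorph _ hd (by simp)
  have hxs : x ∈ h.source := hc.mem_toOpenPartialHomeomorph_source hd (by simp)
  have himg : IsOpen (h '' (h.source ∩ M)) := h.isOpen_image_source_inter hM.isOpen
  -- The Poincaré lemma is applied on a convex set, so `N` is cut down until its image under `w` is
  -- a ball.
  obtain ⟨r, hr, hball⟩ := Metric.isOpen_iff.1 himg (wCoord b φ x) ⟨x, ⟨hxs, hx⟩, rfl⟩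
  set B := Metric.ball (wCoord b φ x) r
  let N : Set V := (h.source ∩ M) ∩ h ⁻¹' B
  have hN : IsOpen N := by
    have : N = (h.source ∩ h ⁻¹' B) ∩ M := by ext; simp [N]; tauto
    rw [this]
    exact (h.isOpen_inter_preimage Metric.isOpen_ball).inter hM.isOpen
  have hNM : N ⊆ M := fun y hy => hy.1.2
  have hNB : wCoord b φ '' N = B := by
    apply Subset.antisymm
    · rintro _ ⟨y, hy, rfl⟩
      exact hy.2
    · intro z hz
      obtain ⟨y, hy, rfl⟩ := hball hz
      exact ⟨y, ⟨hy, hz⟩, rfl⟩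
  have hψ : LeftInvOn h.symm (wCoord b φ) N := fun y hy => h.left_inv hy.1.1
  have hω : ∀ y ∈ N, HasFDerivAt (fun z => pairing n (vCoord b φ (h.symm z)))
      ((pairing n).comp ((vDeriv b φ y).comp (fderiv ℝ h.symm (wCoord b φ y))))
      (wCoord b φ y) := by
    intro y hy
    obtain ⟨-, h2, -⟩ := hb.leftInverse_wCoord hM hφ hN hNM hψ hy
    have h3 := hφ.hasFDerivAt_vCoord (b := b) hM.isOpen (hNM hy)
    rw [← hψ hy] at h3
    have h4 := (pairing n).hasFDerivAt.comp _ (h3.comp _ h2.hasFDerivAt)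
    rw [hψ hy] at h4
    exact h4
  obtain ⟨𝓕, h𝓕⟩ : ∃ 𝓕 : (Fin n → ℂ) → ℂ, ∀ z ∈ B,
      HasFDerivAt 𝓕 (pairing n (vCoord b φ (h.symm z))) z := by
    refine (convex_ball _ r).exists_forall_hasFDerivAt_of_fderiv_symmetric Metric.isOpen_ball
      (fun z hz => ?_) fun z hz a c => ?_
    · obtain ⟨y, hy, rfl⟩ := hNB.ge hz
      exact (hω y hy).differentiableAt.differentiableWithinAt
    · obtain ⟨y, hy, rfl⟩ := hNB.ge hz
      obtain ⟨-, -, h3⟩ := hb.leftInverse_wCoord hM hφ hN hNM hψ hy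
      rw [(hω y hy).fderiv]
      have := hb.pairing_symm hM hφ (hNM hy) (fderiv ℝ h.symm (wCoord b φ y) a)
        (fderiv ℝ h.symm (wCoord b φ y) c)
      -- `dw` undoes the derivative of the inverse chart, which turns the symmetry on `M` into
      -- symmetry of the derivative on the ball.
      rw [h3, h3] at this
      exact this
  refine ⟨N, hNM, hN, ⟨⟨hxs, hx⟩, Metric.mem_ball_self hr⟩, 𝓕, ?_, ?_, ?_⟩
  · rw [hNB]
    exact Metric.isOpen_ball
  · rw [hNB]
    exact fun z hz => (h𝓕 z hz).differentiableAt.differentiableWithinAt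
  · intro y hy j
    rw [(h𝓕 _ (hNB.le ⟨y, hy, rfl⟩)).fderiv, hψ hy, pairing_single]

/-! ### The moment map on `M × V` -/

theorem IsSpecialPotential.isEquivariantMomentMap (hφ : IsSpecialPotential Ω M I φ)
    (hM : IsSpecialKahler Ω M I) (hb : IsSymplecticBasis Ω b) :
    IsEquivariantMomentMap (M ×ˢ (univ : Set V)) (cfgOmega₁ φ) (cfgOmega₂ Ω) (cfgOmega₃ Ω)
      (cfgField b) (cfgMoment b φ) := by
  have hfst : ∀ (t : Fin n → ℝ) (p : V × V), (p + ∑ j, t j • cfgField b j).1 = p.1 := by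
    intro t p
    simp [cfgField, Prod.fst_sum]
  refine ⟨fun t p hp => ⟨by rw [hfst]; exact hp.1, mem_univ _⟩, fun t p hp => ⟨?_, rfl, rfl⟩,
    ?_, ?_, ?_, ?_, fun t p hp => ?_⟩
  · refine LinearMap.ext fun A => LinearMap.ext fun B => ?_
    rw [cfgOmega₁_apply, cfgOmega₁_apply, hfst]
  · refine contDiffOn_pi.2 fun j => contDiffOn_euclidean.2 fun a => ?_
    fin_cases a
    · exact (hφ.xi_contDiffOn hM.isOpen (Sum.inl j)).comp contDiff_fst.contDiffOn fun p hp => hp.1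
    · exact ((coordCLM b (Sum.inr j)).contDiff.comp contDiff_snd).neg.contDiffOn
    · exact ((coordCLM b (Sum.inr j)).contDiff.comp contDiff_fst).contDiffOn
  · rintro p ⟨hp, -⟩ j A
    have h₁ : HasFDerivAt (Prod.fst : V × V → V) (ContinuousLinearMap.fst ℝ V V) p :=
      hasFDerivAt_fst
    have h : HasFDerivAt (fun q => cfgMoment b φ q j 0) _ p :=
      (hφ.hasFDerivAt_xi (b := b) hM.isOpen hp (Sum.inl j)).comp p h₁
    rw [h.fderiv]
    simp [cfgOmega₁_apply, cfgField]
  · rintro p ⟨hp, -⟩ j A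
    have h : HasFDerivAt (fun q => cfgMoment b φ q j 1) _ p :=
      (-(coordCLM b (Sum.inr j)).comp (ContinuousLinearMap.snd ℝ V V)).hasFDerivAt
    rw [h.fderiv]
    simp [cfgOmega₂_apply, cfgField, hb.apply_inl]
  · rintro p ⟨hp, -⟩ j A
    have h : HasFDerivAt (fun q => cfgMoment b φ q j 2) _ p :=
      ((coordCLM b (Sum.inr j)).comp (ContinuousLinearMap.fst ℝ V V)).hasFDerivAt
    rw [h.fderiv]
    simp [cfgOmega₃_apply, cfgField, hb.apply_inl]
  · have hsnd : ∀ j, b.repr (p + ∑ j, t j • cfgField b j).2 (Sum.inr j)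
        = b.repr p.2 (Sum.inr j) := by
      intro j
      simp [cfgField, Prod.snd_sum, map_sum]
    ext j a
    simp only [cfgMoment, hfst, hsnd]

end Coordinates

/-! ### Second derivatives along affine maps -/

theorem fderiv_fderiv_comp_affine {E G : Type*} [NormedAddCommGroup E] [NormedSpace ℝ E]
    [NormedAddCommGroup G] [NormedSpace ℝ G] {F : G → ℝ} {D : Set G} (hD : IsOpen D)
    (hF : ContDiffOn ℝ ∞ F D) (L : E →L[ℝ] G) (p : G) {x : E} (hx : p + L x ∈ D) (a c : E) :
    fderiv ℝ (fderiv ℝ fun y => F (p + L y)) x a c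
      = fderiv ℝ (fderiv ℝ F) (p + L x) (L a) (L c) := by
  have hL : ∀ y, HasFDerivAt (fun y => p + L y) L y := fun y => L.hasFDerivAt.const_add p
  have hev : (fderiv ℝ fun y => F (p + L y))
      =ᶠ[nhds x] fun y => (fderiv ℝ F (p + L y)).comp L := by
    filter_upwards [(hL x).continuousAt (hD.mem_nhds hx)] with y hy
    exact (((hF.contDiffAt (hD.mem_nhds hy)).differentiableAt
      (by simp)).hasFDerivAt.comp y (hL y)).fderiv
  have h₂ : HasFDerivAt (fderiv ℝ F) (fderiv ℝ (fderiv ℝ F) (p + L x)) (p + L x) :=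
    (((hF.fderiv_of_isOpen hD (m := ∞) (by simp)).contDiffAt
      (hD.mem_nhds hx)).differentiableAt (by simp)).hasFDerivAt
  have h₃ := (h₂.comp x (hL x)).clm_comp (hasFDerivAt_const L x)
  rw [hev.fderiv_eq]
  have h₄ : HasFDerivAt (fun y => (fderiv ℝ F (p + L y)).comp L) _ x := h₃
  rw [h₄.fderiv]
  simp

/-! ### The image of the moment map and the function `F = Re 𝓕` -/

section Legendre

variable {n : ℕ}

/-- The projection `𝐱ⱼ ↦ ξⱼ + i sⱼ` of `ℝⁿ ⊗ ℝ³` to `ℂⁿ`. -/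
noncomputable def toW (n : ℕ) : R3n n →L[ℝ] (Fin n → ℂ) :=
  LinearMap.toContinuousLinearMap
    { toFun := fun p j => (p j 0 : ℂ) + Complex.I * (p j 2 : ℂ)
      map_add' := fun p q => by ext j; simp; ring
      map_smul' := fun c p => by ext j; simp; ring }

theorem toW_apply (p : R3n n) (j : Fin n) :
    toW n p j = (p j 0 : ℂ) + Complex.I * (p j 2 : ℂ) := rfl

/-- The real linear form `r ↦ Re ∑ vⱼ wⱼ(r)` on `ℝⁿ ⊗ ℝ³`, as a function of `v`. -/
noncomputable def rePairing (n : ℕ) : (Fin n → ℂ) →L[ℝ] R3n n →L[ℝ] ℝ :=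
  LinearMap.toContinuousLinearMap
    { toFun := fun v => Complex.reCLM.comp (((pairing n v).restrictScalars ℝ).comp (toW n))
      map_add' := fun v v' => by ext; simp
      map_smul' := fun c v => by ext; simp }

theorem rePairing_apply (v : Fin n → ℂ) (r : R3n n) :
    rePairing n v r = (pairing n v (toW n r)).re := rfl

theorem toW_r3unit_zero (j : Fin n) : toW n (r3unit 0 j) = Pi.single j 1 := by
  ext k
  rcases eq_or_ne k j with rfl | h
  · simp [toW_apply, r3unit]
  · simp [toW_apply, r3unit, h]

theorem toW_r3unit_one (j : Fin n) : toW n (r3unit 1 j) = 0 := by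
  ext k
  rcases eq_or_ne k j with rfl | h
  · simp [toW_apply, r3unit]
  · simp [toW_apply, r3unit, h]

variable {V : Type*} [NormedAddCommGroup V] [NormedSpace ℝ V]

theorem Module.Basis.ext_sum_repr {b : Module.Basis (Fin n ⊕ Fin n) ℝ V} {x y : V}
    (h₁ : ∀ j, b.repr x (Sum.inl j) = b.repr y (Sum.inl j))
    (h₂ : ∀ j, b.repr x (Sum.inr j) = b.repr y (Sum.inr j)) : x = y :=
  b.ext_elem fun k => by rcases k with j | j; exacts [h₁ j, h₂ j]

theorem toW_cfgMoment (b : Module.Basis (Fin n ⊕ Fin n) ℝ V) (φ : V → ℝ) (p : V × V) :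
    toW n (cfgMoment b φ p) = wCoord b φ p.1 := rfl

/-- The middle coordinates `-yₙ₊ⱼ` are unrestricted, so the image is a full cylinder over `w(N)`;
its openness follows from that of `w(N)`. -/
theorem mem_image_cfgMoment {b : Module.Basis (Fin n ⊕ Fin n) ℝ V} {φ : V → ℝ} {N : Set V}
    {p : R3n n} : p ∈ cfgMoment b φ '' (N ×ˢ univ) ↔ toW n p ∈ wCoord b φ '' N := by
  constructor
  · rintro ⟨q, hq, rfl⟩
    exact ⟨q.1, hq.1, rfl⟩
  · rintro ⟨x, hx, h⟩
    -- Only `yₙ₊ⱼ` is prescribed; the fibre coordinates `yⱼ` are set to `0`.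
    refine ⟨(x, b.equivFun.symm (Sum.elim 0 fun j => -p j 1)), ⟨hx, mem_univ _⟩, ?_⟩
    have h0 : ∀ j, xi b φ (Sum.inl j) x = p j 0 := fun j => by
      simpa [toW_apply, wCoord] using congrArg Complex.re (congrFun h j)
    have h2 : ∀ j, b.repr x (Sum.inr j) = p j 2 := fun j => by
      simpa [toW_apply, wCoord] using congrArg Complex.im (congrFun h j)
    have h1 : ∀ j, b.repr (b.equivFun.symm (Sum.elim 0 fun j => -p j 1)) (Sum.inr j)
        = -p j 1 := fun j => by
      rw [← b.equivFun_apply, LinearEquiv.apply_symm_apply]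
      rfl
    ext j a
    fin_cases a
    · exact h0 j
    · exact (congrArg Neg.neg (h1 j)).trans (neg_neg _)
    · exact h2 j

theorem sum_smul_cfgField (b : Module.Basis (Fin n ⊕ Fin n) ℝ V) (t : Fin n → ℝ) :
    ∑ j, t j • cfgField b j = (0, -∑ j, t j • b (Sum.inl j)) := by
  ext <;> simp [cfgField, Prod.fst_sum, Prod.snd_sum]

theorem repr_sum_inl (b : Module.Basis (Fin n ⊕ Fin n) ℝ V) (t : Fin n → ℝ) (k : Fin n) :
    b.repr (∑ j, t j • b (Sum.inl j)) (Sum.inl k) = t k := by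
  simp [map_sum, Finsupp.single_apply]

theorem repr_sum_inr (b : Module.Basis (Fin n ⊕ Fin n) ℝ V) (t : Fin n → ℝ) (k : Fin n) :
    b.repr (∑ j, t j • b (Sum.inl j)) (Sum.inr k) = 0 := by
  simp [map_sum]

variable {b : Module.Basis (Fin n ⊕ Fin n) ℝ V} {φ : V → ℝ} {N : Set V} {𝓕 : (Fin n → ℂ) → ℂ}

theorem IsPrepotential.hasFDerivAt (h : IsPrepotential b φ N 𝓕) {x : V} (hx : x ∈ N) :
    HasFDerivAt 𝓕 (pairing n (vCoord b φ x)) (wCoord b φ x) := by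
  rw [← eq_pairing_of_single (h.graph x hx)]
  exact (h.holo.differentiableAt (h.isOpen.mem_nhds ⟨x, hx, rfl⟩)).hasFDerivAt

/-- The value `w` determines `v`, the derivative of `𝓕` there, and `xⱼ = Re vⱼ`, `xₙ₊ⱼ = Im wⱼ`
recover the point. -/
theorem IsPrepotential.injOn (h : IsPrepotential b φ N 𝓕) : InjOn (wCoord b φ) N := by
  intro x hx y hy hxy
  refine Module.Basis.ext_sum_repr (b := b) (fun j => ?_) fun j => ?_
  · have := (h.graph x hx j).trans (hxy ▸ (h.graph y hy j).symm)
    simpa [vCoord] using congrArg Complex.re this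
  · simpa [wCoord] using congrArg Complex.im (congrFun hxy j)

theorem IsPrepotential.isOpen_image (h : IsPrepotential b φ N 𝓕) :
    IsOpen (cfgMoment b φ '' (N ×ˢ univ)) := by
  have : cfgMoment b φ '' (N ×ˢ univ) = toW n ⁻¹' (wCoord b φ '' N) :=
    Set.ext fun p => mem_image_cfgMoment
  rw [this]
  exact h.isOpen.preimage (toW n).continuous

/-- The fibres of the moment map are free orbits. -/
theorem IsPrepotential.existsUnique_translate (h : IsPrepotential b φ N 𝓕) {p q : V × V}
    (hp : p ∈ N ×ˢ (univ : Set V)) (hq : q ∈ N ×ˢ (univ : Set V))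
    (hpq : cfgMoment b φ p = cfgMoment b φ q) :
    ∃! t : Fin n → ℝ, q = p + ∑ j, t j • cfgField b j := by
  have h₁ : p.1 = q.1 := h.injOn hp.1 hq.1 (by rw [← toW_cfgMoment, hpq, toW_cfgMoment])
  have h₂ : ∀ j, b.repr p.2 (Sum.inr j) = b.repr q.2 (Sum.inr j) := fun j => by
    simpa [cfgMoment] using congrArg (fun v => v j 1) hpq
  -- The order of the difference comes from the sign in `Uⱼ = -∂/∂yⱼ`.
  refine ⟨fun j => b.repr p.2 (Sum.inl j) - b.repr q.2 (Sum.inl j), ?_, fun t ht => ?_⟩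
  · beta_reduce
    rw [sum_smul_cfgField]
    refine Prod.ext (by simp [h₁]) (Module.Basis.ext_sum_repr (b := b) (fun j => ?_) fun j => ?_)
    · rw [Prod.snd_add, map_add, map_neg, Finsupp.add_apply, Finsupp.neg_apply, repr_sum_inl]
      ring
    · rw [Prod.snd_add, map_add, map_neg, Finsupp.add_apply, Finsupp.neg_apply, repr_sum_inr,
        h₂, neg_zero, add_zero]
  · funext j
    beta_reduce at ht
    rw [sum_smul_cfgField] at ht
    have := congrArg (fun v : V × V => b.repr v.2 (Sum.inl j)) ht
    simp only [Prod.snd_add, map_add, map_neg, Finsupp.add_apply, Finsupp.neg_apply,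
      repr_sum_inl] at this
    linarith

theorem IsPrepotential.hasFDerivAt_reF (h : IsPrepotential b φ N 𝓕) {x : V} (hx : x ∈ N)
    {p : R3n n} (hp : toW n p = wCoord b φ x) :
    HasFDerivAt (reF 𝓕) (rePairing n (vCoord b φ x)) p := by
  have h₁ := (h.hasFDerivAt hx).restrictScalars ℝ
  rw [← hp] at h₁
  exact Complex.reCLM.hasFDerivAt.comp p (h₁.comp p (toW n).hasFDerivAt)

theorem IsPrepotential.fderiv_reF_unit (h : IsPrepotential b φ N 𝓕) {x : V} (hx : x ∈ N)
    {p : R3n n} (hp : toW n p = wCoord b φ x) (j : Fin n) :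
    fderiv ℝ (reF 𝓕) p (r3unit 0 j) = b.repr x (Sum.inl j) := by
  rw [(h.hasFDerivAt_reF hx hp).fderiv, rePairing_apply, toW_r3unit_zero, pairing_single]
  simp [vCoord]

variable [FiniteDimensional ℝ V] {Ω : LinearMap.BilinForm ℝ V} {M : Set V} {I : V → V →L[ℝ] V}

/-- On `D` the derivative of `F` is `Re ∑ (vⱼ ∘ w⁻¹) dwⱼ`, and `w⁻¹` is smooth by the inverse
function theorem. Differentiating once more replaces `v` by `dv(A)`, where `A` is the tangent vector
to `M` with `dw(A)` equal to the direction of differentiation. Conditions on the Hessian of `F`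
thereby become identities for the pairing of `dv` and `dw`. -/
theorem IsPrepotential.fderiv_reF_smooth (h : IsPrepotential b φ N 𝓕)
    (hb : IsSymplecticBasis Ω b) (hM : IsSpecialKahler Ω M I) (hφ : IsSpecialPotential Ω M I φ)
    (hN : IsOpen N) (hNM : N ⊆ M) {x : V} (hx : x ∈ N) {p : R3n n}
    (hp : toW n p = wCoord b φ x) :
    ContDiffAt ℝ ∞ (fderiv ℝ (reF 𝓕)) p ∧
      ∀ (A : V) (q r : R3n n), wDeriv b φ x A = toW n q →
        fderiv ℝ (fderiv ℝ (reF 𝓕)) p q r = (pairing n (vDeriv b φ x A) (toW n r)).re := by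
  have hψ := h.injOn.leftInvOn_invFunOn
  set ψ := Function.invFunOn (wCoord b φ) N
  obtain ⟨c₁, d₁, e₁⟩ := hb.leftInverse_wCoord hM hφ hN hNM hψ hx
  have hev : fderiv ℝ (reF 𝓕) =ᶠ[nhds p] fun q => rePairing n (vCoord b φ (ψ (toW n q))) := by
    have hmem : toW n ⁻¹' (wCoord b φ '' N) ∈ nhds p :=
      (h.isOpen.preimage (toW n).continuous).mem_nhds (by rw [mem_preimage, hp]; exact ⟨x, hx, rfl⟩)
    filter_upwards [hmem] with q ⟨y, hy, hq⟩
    rw [(h.hasFDerivAt_reF hy hq.symm).fderiv, ← hq, hψ hy]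
  have c₂ : ContDiffAt ℝ ∞ (vCoord b φ) x :=
    (hφ.vCoord_contDiffOn hM.isOpen).contDiffAt (hM.isOpen.mem_nhds (hNM hx))
  have d₂ := hφ.hasFDerivAt_vCoord (b := b) hM.isOpen (hNM hx)
  rw [← hp] at c₁ d₁
  have hψp : ψ (toW n p) = x := by rw [hp, hψ hx]
  rw [← hψp] at c₂ d₂
  refine ⟨ContDiffAt.congr_of_eventuallyEq ?_ hev, fun A q r hA => ?_⟩
  · have c₃ : ContDiffAt ℝ ∞ (fun q => ψ (toW n q)) p :=
      c₁.comp p (toW n).contDiff.contDiffAt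
    have c₄ : ContDiffAt ℝ ∞ (vCoord b φ ∘ fun q => ψ (toW n q)) p := c₂.comp p c₃
    exact (rePairing n).contDiff.contDiffAt.comp p c₄
  · have d₃ : HasFDerivAt (fun q => ψ (toW n q)) _ p :=
      d₁.hasFDerivAt.comp p (toW n).hasFDerivAt
    have d₄ : HasFDerivAt (vCoord b φ ∘ fun q => ψ (toW n q)) _ p := d₂.comp p d₃
    have h₃ : HasFDerivAt (fun q => rePairing n (vCoord b φ (ψ (toW n q)))) _ p :=
      (rePairing n).hasFDerivAt.comp p d₄
    have hAq : fderiv ℝ ψ (toW n p) (toW n q) = A := by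
      apply hb.wDeriv_injective hM hφ (hNM hx)
      rw [hA, hp, e₁]
    rw [hev.fderiv_eq, h₃.fderiv]
    simp only [ContinuousLinearMap.comp_apply, hAq, rePairing_apply, hψp]

theorem IsPrepotential.isLegendreFunction (h : IsPrepotential b φ N 𝓕)
    (hb : IsSymplecticBasis Ω b) (hM : IsSpecialKahler Ω M I) (hφ : IsSpecialPotential Ω M I φ)
    (hN : IsOpen N) (hNM : N ⊆ M) :
    IsLegendreFunction (cfgMoment b φ '' (N ×ˢ univ)) (reF 𝓕) := by
  have hD := h.isOpen_image
  have hsmooth : ContDiffOn ℝ ∞ (reF 𝓕) (cfgMoment b φ '' (N ×ˢ univ)) := by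
    rw [contDiffOn_infty_iff_fderiv_of_isOpen hD]
    refine ⟨fun p hp => ?_, fun p hp => ?_⟩
    · obtain ⟨x, hx, hxp⟩ := mem_image_cfgMoment.1 hp
      exact (h.hasFDerivAt_reF hx hxp.symm).differentiableAt.differentiableWithinAt
    · obtain ⟨x, hx, hxp⟩ := mem_image_cfgMoment.1 hp
      exact (h.fderiv_reF_smooth hb hM hφ hN hNM hx hxp.symm).1.contDiffWithinAt
  have hsurj : ∀ x ∈ N, ∀ a, ∃ A, wDeriv b φ x A = a := by
    intro x hx a
    obtain ⟨e, he⟩ := hb.exists_wDeriv_equiv hM hφ (hNM hx)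
    exact ⟨e.symm a, by rw [← he]; simp⟩
  refine ⟨hD, hsmooth, ?_, ?_, ?_, ?_⟩
  · intro c p x hx
    let L : EuclideanSpace ℝ (Fin 3) →L[ℝ] R3n n :=
      ContinuousLinearMap.pi fun j => c j • ContinuousLinearMap.id ℝ _
    have hL : Continuous fun y => p + L y := continuous_const.add L.continuous
    have hx' : p + L x ∈ cfgMoment b φ '' (N ×ˢ univ) := hx
    constructor
    · have h₁ : ContDiffAt ℝ 2 (reF 𝓕) (p + L x) :=
        (hsmooth.contDiffAt (hD.mem_nhds hx')).of_le ENat.LEInfty.out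
      have h₂ : ContDiffAt ℝ 2 (fun y => p + L y) x := (contDiff_const.add L.contDiff).contDiffAt
      have h₃ : ContDiffAt ℝ 2 (reF 𝓕 ∘ fun y => p + L y) x := h₁.comp x h₂
      exact h₃
    · filter_upwards [hL.continuousAt (hD.mem_nhds hx')] with y hy
      obtain ⟨m, hm, hmp⟩ := mem_image_cfgMoment.1 hy
      -- If `A` lifts the `ξ` direction, then `IA` lifts the `Im z` direction, since `w` is
      -- holomorphic; `F` is constant in the `Re z` direction. The three second derivatives are `h`,
      -- `0` and `-h`.
      obtain ⟨A, hA⟩ := hsurj m hm (toW n (L (EuclideanSpace.single 0 1)))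
      have hIA : wDeriv b φ m (I m A) = toW n (L (EuclideanSpace.single 2 1)) := by
        rw [hb.wDeriv_map hM hφ (hNM hm), hA]
        ext j
        simp [toW_apply, L]
      have h1 : toW n (L (EuclideanSpace.single 1 1)) = 0 := by
        ext j
        simp [toW_apply, L]
      have hs := (h.fderiv_reF_smooth hb hM hφ hN hNM hm hmp.symm).2
      have hd : ∀ a : EuclideanSpace ℝ (Fin 3),
          iteratedFDeriv ℝ 2 (fun y => reF 𝓕 (p + fun j => c j • y)) y ![a, a]
            = fderiv ℝ (fderiv ℝ (reF 𝓕)) (p + L y) (L a) (L a) := by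
        intro a
        rw [iteratedFDeriv_two_apply]
        exact fderiv_fderiv_comp_affine hD hsmooth L p hy a a
      rw [InnerProductSpace.laplacian_eq_iteratedFDeriv_orthonormalBasis _
        (EuclideanSpace.basisFun (Fin 3) ℝ)]
      simp only [Fin.sum_univ_three, EuclideanSpace.basisFun_apply, hd, Pi.zero_apply]
      rw [hs A _ _ hA, ← hA, hs 0 _ _ (by rw [h1, map_zero]), hs (I m A) _ _ hIA, ← hIA,
        hb.re_pairing_map hM hφ (hNM hm), h1]
      simp
  · intro p hp j k
    obtain ⟨x, hx, hxp⟩ := mem_image_cfgMoment.1 hp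
    have hs := (h.fderiv_reF_smooth hb hM hφ hN hNM hx hxp.symm).2
    -- Both sides vanish, as `F` does not depend on `Re z`.
    obtain ⟨A, hA⟩ := hsurj x hx (toW n (r3unit 2 j))
    rw [hs A _ _ hA, hs 0 _ _ (by rw [toW_r3unit_one, map_zero]), toW_r3unit_one]
    simp
  · intro p hp a ha
    obtain ⟨x, hx, hxp⟩ := mem_image_cfgMoment.1 hp
    have hs := (h.fderiv_reF_smooth hb hM hφ hN hNM hx hxp.symm).2
    -- A kernel vector `a` is real, so if `dw(A) = a` the second derivative of `F` along `q` is
    -- `g(A, A)`. Its vanishing forces `A = 0`, hence `a = 0`.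
    set q : R3n n := ∑ k, a k • r3unit 0 k
    have hq : ∀ j, toW n q j = a j := by
      intro j
      simp only [q, map_sum, map_smul, toW_r3unit_zero]
      simp [Finset.sum_apply, Pi.single_apply]
    obtain ⟨A, hA⟩ := hsurj x hx (toW n q)
    have h₁ : fderiv ℝ (fderiv ℝ (reF 𝓕)) p q q = 0 := by
      have : ∀ j, fderiv ℝ (fderiv ℝ (reF 𝓕)) p (r3unit 0 j) q = 0 := fun j => by
        rw [← ha j]
        simp only [q, map_sum, map_smul, smul_eq_mul, mul_comm]
      conv_lhs => enter [1, 2]; simp only [q]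
      simp [this]
    rw [hs A q q hA, ← hA, hb.re_pairing_of_real hM hφ (hNM hx) fun j => by
      rw [hA, hq, Complex.ofReal_im]] at h₁
    have hA0 : A = 0 := by
      by_contra hne
      exact (hM.pos x (hNM hx) A hne).ne' h₁
    funext j
    have := hq j
    rw [← hA, hA0, map_zero] at this
    exact (Complex.ofReal_eq_zero.1 this.symm :)
  · intro ξ ξ' z hξ hξ' heq
    obtain ⟨x, hx, hxp⟩ := mem_image_cfgMoment.1 hξ
    obtain ⟨x', hx', hxp'⟩ := mem_image_cfgMoment.1 hξ'
    -- Since `∂F/∂ξⱼ = xⱼ` and `Im zⱼ = xₙ₊ⱼ`, the given data fix the point of `N`, and with it `ξ`.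
    have hxx : x = x' := by
      refine Module.Basis.ext_sum_repr (b := b) (fun j => ?_) fun j => ?_
      · rw [← h.fderiv_reF_unit hx hxp.symm, ← h.fderiv_reF_unit hx' hxp'.symm, heq]
      · have h1 := congrArg Complex.im (congrFun hxp j)
        have h2 := congrArg Complex.im (congrFun hxp' j)
        simp [toW_apply, wCoord, r3pt] at h1 h2
        rw [h1, h2]
    funext j
    have h1 := congrArg Complex.re (congrFun hxp j)
    have h2 := congrArg Complex.re (congrFun hxp' j)
    simp [toW_apply, wCoord, r3pt] at h1 h2
    rw [← h1, ← h2, hxx]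

end Legendre

/-! ### The Kähler potential of the Legendre transform -/

section LegendrePotential

variable {n : ℕ} {V : Type*} [NormedAddCommGroup V] [NormedSpace ℝ V] [FiniteDimensional ℝ V]
  {b : Module.Basis (Fin n ⊕ Fin n) ℝ V} {φ : V → ℝ} {N : Set V} {𝓕 : (Fin n → ℂ) → ℂ}
  {Ω : LinearMap.BilinForm ℝ V} {M : Set V} {I : V → V →L[ℝ] V}

variable (b) in
/-- The linear isomorphism `uⱼ = (xⱼ + i yⱼ) / 2`, `zⱼ = i (xₙ₊ⱼ + i yₙ₊ⱼ)`. -/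
noncomputable def toUZ : (V × V) ≃L[ℝ] UZ n :=
  LinearEquiv.toContinuousLinearEquiv
    { toFun := fun p =>
        (fun j => ((b.repr p.1 (Sum.inl j) : ℂ) + Complex.I * (b.repr p.2 (Sum.inl j) : ℂ)) / 2,
         fun j => Complex.I *
          ((b.repr p.1 (Sum.inr j) : ℂ) + Complex.I * (b.repr p.2 (Sum.inr j) : ℂ)))
      map_add' := fun p q => by ext j <;> simp <;> ring
      map_smul' := fun c p => by ext j <;> simp <;> ring
      invFun := fun q =>
        (b.equivFun.symm (Sum.elim (fun j => 2 * (q.1 j).re) fun j => (q.2 j).im),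
         b.equivFun.symm (Sum.elim (fun j => 2 * (q.1 j).im) fun j => -(q.2 j).re))
      left_inv := fun p => by
        refine Prod.ext ?_ ?_ <;> dsimp only <;> rw [LinearEquiv.symm_apply_eq] <;>
          ext (j | j) <;> simp [mul_div_cancel₀]
      right_inv := fun q => by
        have h : ∀ (f : Fin n ⊕ Fin n → ℝ) k, b.repr (b.equivFun.symm f) k = f k := fun f k => by
          rw [← b.equivFun_apply, LinearEquiv.apply_symm_apply]
        ext j
        · simp only [h, Sum.elim_inl]
          apply Complex.ext <;> simp
        · simp only [h, Sum.elim_inr]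
          apply Complex.ext <;> simp }

theorem toUZ_fst (p : V × V) (j : Fin n) : (toUZ b p).1 j
    = ((b.repr p.1 (Sum.inl j) : ℂ) + Complex.I * (b.repr p.2 (Sum.inl j) : ℂ)) / 2 := rfl

theorem toUZ_snd (p : V × V) (j : Fin n) : (toUZ b p).2 j
    = Complex.I * ((b.repr p.1 (Sum.inr j) : ℂ) + Complex.I * (b.repr p.2 (Sum.inr j) : ℂ)) := rfl

theorem re_toUZ_fst (p : V × V) (j : Fin n) :
    2 * ((toUZ b p).1 j).re = b.repr p.1 (Sum.inl j) := by
  simp [toUZ_fst, mul_div_cancel₀]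

/-- `u` and `z` are complex linear in `x + iy`, so multiplication by `i` corresponds to `J₁`. -/
theorem I_smul_toUZ (A : V × V) : Complex.I • toUZ b A = toUZ b (-A.2, A.1) := by
  ext j
  · simp only [Prod.smul_fst, Pi.smul_apply, smul_eq_mul, toUZ_fst]
    apply Complex.ext <;> simp [neg_div]
  · simp only [Prod.smul_snd, Pi.smul_apply, smul_eq_mul, toUZ_snd]
    apply Complex.ext <;> simp

theorem toUZ_add_sum_smul_cfgField (p : V × V) (t : Fin n → ℝ) :
    toUZ b (p + ∑ j, t j • cfgField b j)
      = toUZ b p + ((fun j => -(Complex.I / 2) * (t j : ℂ)), 0) := by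
  rw [map_add, sum_smul_cfgField]
  congr 1
  ext j
  · simp only [toUZ_fst, map_neg, Finsupp.neg_apply, repr_sum_inl]
    simp; ring
  · simp only [toUZ_snd, map_neg, Finsupp.neg_apply, repr_sum_inr]
    simp

/-- The constants combine as `2i · ½ · i = -1`, so the form is `-∑ d(xⱼ + iyⱼ) ∧ d(xₙ₊ⱼ + iyₙ₊ⱼ)`.
-/
theorem duDz_toUZ (hb : IsSymplecticBasis Ω b) (hΩ : Ω.IsAlt) (A B : V × V) :
    duDz (toUZ b A) (toUZ b B)
      = ((-(Ω A.1 B.1 - Ω A.2 B.2) : ℝ) : ℂ) + Complex.I * ((-(Ω A.1 B.2 + Ω A.2 B.1) : ℝ) : ℂ) := by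
  simp only [hb.apply_eq_sum hΩ, duDz, toUZ_fst, toUZ_snd]
  rw [← Finset.sum_sub_distrib, ← Finset.sum_add_distrib]
  push_cast
  rw [Finset.mul_sum, ← Finset.sum_neg_distrib, ← Finset.sum_neg_distrib, Finset.mul_sum,
    ← Finset.sum_add_distrib]
  refine Finset.sum_congr rfl fun j _ => ?_
  apply Complex.ext <;> simp <;> ring

theorem legendreOmega₂_toUZ (hb : IsSymplecticBasis Ω b) (hΩ : Ω.IsAlt) (p A B : V × V) :
    legendreOmega₂ (toUZ b p) (toUZ b A) (toUZ b B) = cfgOmega₂ Ω p A B := by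
  have h : legendreOmega₂ (toUZ b p) (toUZ b A) (toUZ b B) = (duDz (toUZ b A) (toUZ b B)).re := rfl
  rw [h, duDz_toUZ hb hΩ, cfgOmega₂_apply]
  simp

theorem legendreOmega₃_toUZ (hb : IsSymplecticBasis Ω b) (hΩ : Ω.IsAlt) (p A B : V × V) :
    legendreOmega₃ (toUZ b p) (toUZ b A) (toUZ b B) = cfgOmega₃ Ω p A B := by
  have h : legendreOmega₃ (toUZ b p) (toUZ b A) (toUZ b B) = (duDz (toUZ b A) (toUZ b B)).im := rfl
  rw [h, duDz_toUZ hb hΩ, cfgOmega₃_apply]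
  simp

theorem r3pt_toUZ (p : V × V) : r3pt (fun j => xi b φ (Sum.inl j) p.1) (toUZ b p).2
    = cfgMoment b φ p := by
  ext j a
  fin_cases a <;> simp [r3pt, cfgMoment, toUZ_snd]

/-- A dual variable comes from some point of `N`; its coordinates are forced to be `xⱼ = ∂F/∂ξⱼ = uⱼ
+ ūⱼ` and `xₙ₊ⱼ = Im zⱼ`. This yields both the description of `X_F` and the uniqueness of `ξ`. -/
theorem IsPrepotential.isLegendreDual_iff (h : IsPrepotential b φ N 𝓕) (p : V × V)
    (ξ : Fin n → ℝ) :
    IsLegendreDual (cfgMoment b φ '' (N ×ˢ univ)) (reF 𝓕) (toUZ b p) ξ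
      ↔ p.1 ∈ N ∧ ξ = fun j => xi b φ (Sum.inl j) p.1 := by
  constructor
  · rintro ⟨hD, hF⟩
    obtain ⟨x, hx, hxp⟩ := mem_image_cfgMoment.1 hD
    have hxx : x = p.1 := by
      refine Module.Basis.ext_sum_repr (b := b) (fun j => ?_) fun j => ?_
      · rw [← h.fderiv_reF_unit hx hxp.symm, hF, re_toUZ_fst]
      · simpa [toW_apply, wCoord, r3pt, toUZ_snd] using congrArg Complex.im (congrFun hxp j)
    subst hxx
    refine ⟨hx, funext fun j => ?_⟩
    simpa [toW_apply, wCoord, r3pt] using (congrArg Complex.re (congrFun hxp j)).symm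
  · rintro ⟨hp, rfl⟩
    rw [IsLegendreDual, r3pt_toUZ]
    refine ⟨⟨p, ⟨hp, mem_univ _⟩, rfl⟩, fun j => ?_⟩
    rw [h.fderiv_reF_unit hp (toW_cfgMoment b φ p), re_toUZ_fst]

theorem IsPrepotential.image_toUZ (h : IsPrepotential b φ N 𝓕) :
    toUZ b '' (N ×ˢ univ) = legendreSpace (cfgMoment b φ '' (N ×ˢ univ)) (reF 𝓕) := by
  ext q
  obtain ⟨p, rfl⟩ := (toUZ b).surjective q
  rw [(toUZ b).injective.mem_set_image]
  constructor
  · rintro ⟨hp, -⟩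
    exact ⟨_, (h.isLegendreDual_iff p _).2 ⟨hp, rfl⟩⟩
  · rintro ⟨ξ, hξ⟩
    exact ⟨((h.isLegendreDual_iff p _).1 hξ).1, mem_univ _⟩

theorem IsPrepotential.legendreXi_toUZ (h : IsPrepotential b φ N 𝓕) {p : V × V} (hp : p.1 ∈ N) :
    legendreXi (cfgMoment b φ '' (N ×ˢ univ)) (reF 𝓕) (toUZ b p)
      = fun j => xi b φ (Sum.inl j) p.1 :=
  ((h.isLegendreDual_iff p _).1
    (Classical.epsilon_spec ⟨_, (h.isLegendreDual_iff p _).2 ⟨hp, rfl⟩⟩)).2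

variable (b φ 𝓕) in
/-- The Kähler potential of the Legendre transform as a function on `N`. -/
noncomputable def potentialOn (x : V) : ℝ :=
  (𝓕 (wCoord b φ x)).re - ∑ k, b.repr x (Sum.inl k) * xi b φ (Sum.inl k) x

theorem IsPrepotential.legendreK_toUZ (h : IsPrepotential b φ N 𝓕) {p : V × V} (hp : p.1 ∈ N) :
    legendreK (cfgMoment b φ '' (N ×ˢ univ)) (reF 𝓕) (toUZ b p) = potentialOn b φ 𝓕 p.1 := by
  simp only [legendreK, h.legendreXi_toUZ hp, r3pt_toUZ, re_toUZ_fst]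
  rfl

/-- The Legendre cancellation: `Re ∑ vⱼ dwⱼ = ∑ (xⱼ dξⱼ - ξₙ₊ⱼ dxₙ₊ⱼ)`, and subtracting `d(∑ xⱼ ξⱼ)`
leaves `-∑ (ξⱼ dxⱼ + ξₙ₊ⱼ dxₙ₊ⱼ) = -dφ`. -/
theorem IsPrepotential.hasFDerivAt_potentialOn (h : IsPrepotential b φ N 𝓕)
    (hφ : IsSpecialPotential Ω M I φ) (hM : IsOpen M) (hNM : N ⊆ M) {x : V} (hx : x ∈ N) :
    HasFDerivAt (potentialOn b φ 𝓕) (-fderiv ℝ φ x) x := by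
  have h₁ : HasFDerivAt (𝓕 ∘ wCoord b φ) _ x :=
    ((h.hasFDerivAt hx).restrictScalars ℝ).comp x (hφ.hasFDerivAt_wCoord hM (hNM hx))
  have h₂ : HasFDerivAt (fun x => (𝓕 (wCoord b φ x)).re) _ x :=
    Complex.reCLM.hasFDerivAt.comp x h₁
  have h₃ : HasFDerivAt (fun y => ∑ k, b.repr y (Sum.inl k) * xi b φ (Sum.inl k) y) _ x :=
    HasFDerivAt.fun_sum fun k _ => (coordCLM b (Sum.inl k)).hasFDerivAt.mul
      (hφ.hasFDerivAt_xi hM (hNM hx) (Sum.inl k))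
  refine (h₂.sub h₃).congr_fderiv (ContinuousLinearMap.ext fun A => ?_)
  have h₄ : (pairing n (vCoord b φ x) (wDeriv b φ x A)).re
      = ∑ j, (b.repr x (Sum.inl j) * hessian φ x A (b (Sum.inl j))
        - xi b φ (Sum.inr j) x * b.repr A (Sum.inr j)) := by
    rw [pairing_apply, Complex.re_sum]
    refine Finset.sum_congr rfl fun j _ => ?_
    simp [vCoord, wDeriv_apply]
  have h₅ : ∀ L : V →L[ℝ] ℝ, L = ∑ k, (b.repr x (Sum.inl k) • (hessian φ x).flip (b (Sum.inl k))
      + xi b φ (Sum.inl k) x • coordCLM b (Sum.inl k)) →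
      L A = ∑ k, (b.repr x (Sum.inl k) * hessian φ x A (b (Sum.inl k))
        + xi b φ (Sum.inl k) x * b.repr A (Sum.inl k)) := by
    rintro _ rfl
    simp
  have h₆ := h₅ _ rfl
  refine (congrArg₂ (· - ·) h₄ h₆).trans ?_
  rw [neg_apply, fderiv_apply_eq_sum_xi b, ← Finset.sum_sub_distrib, ← Finset.sum_neg_distrib]
  exact Finset.sum_congr rfl fun j _ => by ring

/-- In the coordinates `(x, y)` the potential depends on `x` alone, and there its derivative is
`-dφ`. -/
theorem IsPrepotential.hessian_legendreK (h : IsPrepotential b φ N 𝓕)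
    (hφ : IsSpecialPotential Ω M I φ) (hM : IsOpen M) (hN : IsOpen N) (hNM : N ⊆ M) {p : V × V}
    (hp : p.1 ∈ N) (A B : V × V) :
    hessian (legendreK (cfgMoment b φ '' (N ×ˢ univ)) (reF 𝓕)) (toUZ b p) (toUZ b A) (toUZ b B)
      = -hessian φ p.1 A.1 B.1 := by
  let L : UZ n →L[ℝ] V :=
    (ContinuousLinearMap.fst ℝ V V).comp ((toUZ b).symm : UZ n →L[ℝ] V × V)
  have hL : ∀ p : V × V, L (toUZ b p) = p.1 := fun p => by simp [L]
  have hk : ∀ x ∈ N, HasFDerivAt (potentialOn b φ 𝓕) (-fderiv ℝ φ x) x := fun x hx =>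
    h.hasFDerivAt_potentialOn hφ hM hNM hx
  have hks : ContDiffOn ℝ ∞ (potentialOn b φ 𝓕) N := by
    rw [contDiffOn_infty_iff_fderiv_of_isOpen hN]
    exact ⟨fun x hx => (hk x hx).differentiableAt.differentiableWithinAt,
      ((hφ.fderiv_contDiffOn hM).mono hNM).neg.congr fun x hx => (hk x hx).fderiv⟩
  have hev : legendreK (cfgMoment b φ '' (N ×ˢ univ)) (reF 𝓕)
      =ᶠ[nhds (toUZ b p)] fun q => potentialOn b φ 𝓕 (0 + L q) := by
    filter_upwards [(hN.preimage L.continuous).mem_nhds (by rwa [mem_preimage, hL])] with q hq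
    obtain ⟨r, rfl⟩ := (toUZ b).surjective q
    rw [mem_preimage, hL] at hq
    rw [h.legendreK_toUZ hq, hL, zero_add]
  have hev₂ : fderiv ℝ (potentialOn b φ 𝓕) =ᶠ[nhds p.1] fun x => -fderiv ℝ φ x := by
    filter_upwards [hN.mem_nhds hp] with x hx using (hk x hx).fderiv
  rw [hessian, hev.fderiv.fderiv_eq, fderiv_fderiv_comp_affine hN hks L 0
    (by rwa [hL, zero_add]), hL, hL, hL, zero_add, hev₂.fderiv_eq, fderiv_fun_neg]
  rfl

theorem IsPrepotential.legendreOmega₁_toUZ (h : IsPrepotential b φ N 𝓕)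
    (hφ : IsSpecialPotential Ω M I φ) (hM : IsOpen M) (hN : IsOpen N) (hNM : N ⊆ M) {p : V × V}
    (hp : p.1 ∈ N) (A B : V × V) :
    legendreOmega₁ (cfgMoment b φ '' (N ×ˢ univ)) (reF 𝓕) (toUZ b p) (toUZ b A) (toUZ b B)
      = cfgOmega₁ φ p A B := by
  have e : legendreOmega₁ (cfgMoment b φ '' (N ×ˢ univ)) (reF 𝓕) (toUZ b p) (toUZ b A) (toUZ b B)
      = -(hessian (legendreK (cfgMoment b φ '' (N ×ˢ univ)) (reF 𝓕)) (toUZ b p)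
          (Complex.I • toUZ b A) (toUZ b B)
        - hessian (legendreK (cfgMoment b φ '' (N ×ˢ univ)) (reF 𝓕)) (toUZ b p)
          (toUZ b A) (Complex.I • toUZ b B)) := rfl
  rw [e, I_smul_toUZ, I_smul_toUZ, h.hessian_legendreK hφ hM hN hNM hp,
    h.hessian_legendreK hφ hM hN hNM hp, cfgOmega₁_apply, map_neg, map_neg, neg_apply,
    hφ.hessian_symm hM (hNM hp) B.1]
  ring

theorem IsPrepotential.legendreMetric_toUZ (h : IsPrepotential b φ N 𝓕)
    (hφ : IsSpecialPotential Ω M I φ) (hM : IsOpen M) (hN : IsOpen N) (hNM : N ⊆ M) {p : V × V}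
    (hp : p.1 ∈ N) (A B : V × V) :
    legendreMetric (cfgMoment b φ '' (N ×ˢ univ)) (reF 𝓕) (toUZ b p) (toUZ b A) (toUZ b B)
      = cfgMetric φ p A B := by
  have e : legendreMetric (cfgMoment b φ '' (N ×ˢ univ)) (reF 𝓕) (toUZ b p) (toUZ b A) (toUZ b B)
      = legendreOmega₁ (cfgMoment b φ '' (N ×ˢ univ)) (reF 𝓕) (toUZ b p) (toUZ b A)
        (Complex.I • toUZ b B) := rfl
  rw [e, I_smul_toUZ, h.legendreOmega₁_toUZ hφ hM hN hNM hp, cfgOmega₁_apply, cfgMetric_apply,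
    map_neg, neg_apply, hφ.hessian_symm hM (hNM hp) B.2]
  ring

theorem IsPrepotential.exists_legendreK_eq (h : IsPrepotential b φ N 𝓕)
    (hφ : IsSpecialPotential Ω M I φ) (hM : IsOpen M) (hN : IsOpen N) (hNM : N ⊆ M)
    (hc : IsPreconnected N) :
    ∃ c : ℝ, ∀ p ∈ N ×ˢ (univ : Set V),
      legendreK (cfgMoment b φ '' (N ×ˢ univ)) (reF 𝓕) (toUZ b p) = -φ p.1 + c := by
  have hd : ∀ x ∈ N, HasFDerivAt (fun x => potentialOn b φ 𝓕 x + φ x) 0 x := fun x hx => by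
    have := (h.hasFDerivAt_potentialOn hφ hM hNM hx).add
      (hφ.differentiableAt hM (hNM hx)).hasFDerivAt
    rwa [neg_add_cancel] at this
  obtain ⟨c, hc⟩ := hN.exists_is_const_of_fderiv_eq_zero hc
    (fun x hx => (hd x hx).differentiableAt.differentiableWithinAt) fun x hx => (hd x hx).fderiv
  refine ⟨c, fun p hp => ?_⟩
  rw [h.legendreK_toUZ hp.1]
  linarith [hc p.1 hp.1]

end LegendrePotential

/-! ### The main theorem -/

theorem proposition5 {n : ℕ} {V : Type*} [NormedAddCommGroup V] [NormedSpace ℝ V]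
    [FiniteDimensional ℝ V] (Ω : LinearMap.BilinForm ℝ V) (M : Set V) (I : V → V →L[ℝ] V)
    (φ : V → ℝ) (hM : IsSpecialKahler Ω M I) (hφ : IsSpecialPotential Ω M I φ)
    (b : Module.Basis (Fin n ⊕ Fin n) ℝ V) (hb : IsSymplecticBasis Ω b) :
    -- the three forms define a hyperkähler metric on `M × V`
    IsHyperkahler (M ×ˢ (univ : Set V)) (cfgOmega₁ φ) (cfgOmega₂ Ω) (cfgOmega₃ Ω) (cfgMetric φ) ∧
    -- the action of `ℝⁿ` generated by `-∂/∂yⱼ`, `1 ≤ j ≤ n`, has an equivariant moment map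
    IsEquivariantMomentMap (M ×ˢ (univ : Set V)) (cfgOmega₁ φ) (cfgOmega₂ Ω) (cfgOmega₃ Ω)
      (cfgField b) (cfgMoment b φ) ∧
    -- holomorphic prepotentials exist locally
    (∀ x ∈ M, ∃ N ⊆ M, IsOpen N ∧ x ∈ N ∧ ∃ 𝓕, IsPrepotential b φ N 𝓕) ∧
    -- wherever there is one, the metric is the Legendre transform of its real part
    ∀ N ⊆ M, IsOpen N → ∀ 𝓕, IsPrepotential b φ N 𝓕 →
      let X : Set (V × V) := N ×ˢ univ
      let D : Set (R3n n) := cfgMoment b φ '' X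
      let F : R3n n → ℝ := reF 𝓕
      IsLegendreFunction D F ∧
      -- `X → D` is a principal `ℝⁿ`-bundle: its fibres are free orbits
      (∀ p ∈ X, ∀ q ∈ X, cfgMoment b φ p = cfgMoment b φ q →
        ∃! t : Fin n → ℝ, q = p + ∑ j, t j • cfgField b j) ∧
      -- the Legendre transform construction gives a hyperkähler structure
      IsHyperkahler (legendreSpace D F) (legendreOmega₁ D F) legendreOmega₂ legendreOmega₃
        (legendreMetric D F) ∧
      -- and `uⱼ = (xⱼ + i yⱼ) / 2`, `zⱼ = i (xₙ₊ⱼ + i yₙ₊ⱼ)` identifies it with that of `X`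
      ∃ Φ : (V × V) ≃L[ℝ] UZ n,
        (∀ x y : V, ∀ j : Fin n,
          (Φ (x, y)).1 j
            = ((b.repr x (Sum.inl j) : ℂ) + Complex.I * (b.repr y (Sum.inl j) : ℂ)) / 2 ∧
          (Φ (x, y)).2 j
            = Complex.I *
              ((b.repr x (Sum.inr j) : ℂ) + Complex.I * (b.repr y (Sum.inr j) : ℂ))) ∧
        Φ '' X = legendreSpace D F ∧
        (∀ p ∈ X, ∀ A B : V × V,
          legendreOmega₁ D F (Φ p) (Φ A) (Φ B) = cfgOmega₁ φ p A B ∧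
          legendreOmega₂ (Φ p) (Φ A) (Φ B) = cfgOmega₂ Ω p A B ∧
          legendreOmega₃ (Φ p) (Φ A) (Φ B) = cfgOmega₃ Ω p A B ∧
          legendreMetric D F (Φ p) (Φ A) (Φ B) = cfgMetric φ p A B) ∧
        -- the moment map of `X` is `(ξ, z)`, and `ℝⁿ` acts by translations of `Im u`
        (∀ p ∈ X, cfgMoment b φ p = r3pt (legendreXi D F (Φ p)) (Φ p).2) ∧
        (∀ (p : V × V) (t : Fin n → ℝ),
          Φ (p + ∑ j, t j • cfgField b j)
            = Φ p + ((fun j => -(Complex.I / 2) * (t j : ℂ)), 0)) ∧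
        -- the potential of the construction is `-φ` up to a constant
        (IsPreconnected N → ∃ c : ℝ, ∀ p ∈ X, legendreK D F (Φ p) = -φ p.1 + c) := by
  refine ⟨hφ.isHyperkahler hM, hφ.isEquivariantMomentMap hM hb,
    fun x hx => hb.exists_prepotential hM hφ hx, ?_⟩
  intro N hNM hN 𝓕 h X D F
  have h₁ : ∀ p ∈ X, ∀ A B, legendreOmega₁ D F (toUZ b p) (toUZ b A) (toUZ b B)
      = cfgOmega₁ φ p A B := fun p hp A B => h.legendreOmega₁_toUZ hφ hM.isOpen hN hNM hp.1 A B
  have hG : ∀ p ∈ X, ∀ A B, legendreMetric D F (toUZ b p) (toUZ b A) (toUZ b B)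
      = cfgMetric φ p A B := fun p hp A B => h.legendreMetric_toUZ hφ hM.isOpen hN hNM hp.1 A B
  -- The hyperkähler structure on `X_F` is the image of the one on `N × V`, so positivity and the
  -- quaternionic identities need no separate check.
  have hyp := ((hφ.mono hNM).isHyperkahler (hM.mono hN hNM)).image (toUZ b) h₁
    (fun p _ A B => legendreOmega₂_toUZ hb hM.alt p A B)
    (fun p _ A B => legendreOmega₃_toUZ hb hM.alt p A B) hG
  rw [h.image_toUZ] at hyp
  refine ⟨h.isLegendreFunction hb hM hφ hN hNM,
    fun p hp q hq hpq => h.existsUnique_translate hp hq hpq, hyp, toUZ b,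
    fun x y j => ⟨toUZ_fst _ _, toUZ_snd _ _⟩, h.image_toUZ,
    fun p hp A B => ⟨h₁ p hp A B, legendreOmega₂_toUZ hb hM.alt p A B,
      legendreOmega₃_toUZ hb hM.alt p A B, hG p hp A B⟩,
    fun p hp => ?_, toUZ_add_sum_smul_cfgField,
    h.exists_legendreK_eq hφ hM.isOpen hN hNM⟩
  rw [h.legendreXi_toUZ hp.1, r3pt_toUZ]
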